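/- Let $G$ be a finite simple graph that is toroidal, i.e. that can be embedded in the torus (planar graphs are included; combinatorially: $G$ has a rotation system for which the genera of its connected components add up to at most $1$). Suppose that $G$ has no subgraph (induced or not) isomorphic to one of the following six graphs, in which no vertices and edges other than those described are present or identified: (a) a $4$-cycle with a chord; (b) a $5$-cycle with a chord; (c) a $6$-cycle with a chord joining two opposite vertices; (d) a $6$-cycle $v_1v_2\dots v_6$ and one further vertex adjacent to exactly $v_1$ and $v_2$; (e) a $5$-cycle $v_1v_2v_3v_4v_5$ together with a triangle $v_2v_3x$ and a $4$-cycle $v_1v_2yz$, where $x,y,z$ are three further vertices; (f) a $5$-cycle $v_1v_2v_3v_4v_5$ together with a triangle $v_3v_4x$ and a $4$-cycle $v_1v_2yz$, where $x,y,z$ are three further vertices. Then $G$ is $(2,1)$-decomposable: it has a subgraph $H$ of maximum degree $\Delta(H)\le 1$ such that $G-E(H)$ is $2$-degenerate, i.e. every nonempty subgraph of $G-E(H)$ has a vertex of degree at most $2$. Moreover, for each $(i,j)\in\{(3,4),(3,6),(4,6),(4,7)\}$, every toroidal graph that contains neither a cycle of length $i$ nor a cycle of length $j$ contains none of the graphs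 (a)–(f) as a subgraph (so that it is $(2,1)$-decomposable). -/

import Mathlib

namespace ToroidalDecomposition

/-- A rotation system on a simple graph `G`: a permutation of the darts (oriented edges) whose
cycles are exactly the sets of darts leaving a given non-isolated vertex, that is, a cyclic order
of the edge-ends around every vertex. Rotation systems are the combinatorial form of the 2-cell
embeddings of the components of `G` in closed orientable surfaces. -/
structure RotationSystem {V : Type*} (G : SimpleGraph V) where
  /-- The next dart around the initial vertex. -/
  next : Equiv.Perm G.Dart
  next_fst : ∀ d : G.Dart, (next d).fst = d.fst
  sameCycle_of_fst_eq : ∀ d e : G.Dart, d.fst = e.fst → next.SameCycle d e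

/-- The reversal of darts, as a permutation. -/
def dartReverse {V : Type*} (G : SimpleGraph V) : Equiv.Perm G.Dart where
  toFun := SimpleGraph.Dart.symm
  invFun := SimpleGraph.Dart.symm
  left_inv := SimpleGraph.Dart.symm_symm
  right_inv := SimpleGraph.Dart.symm_symm

namespace RotationSystem

variable {V : Type*} {G : SimpleGraph V} (ρ : RotationSystem G)

/-- Face tracing: traverse a dart, then leave its terminal vertex along the next dart. -/
def facePerm : Equiv.Perm G.Dart := ρ.next * dartReverse G

/-- The number of faces, counted over the components separately: one face for every cycle of the
face-tracing permutation (fixed points included), and one face for every isolated vertex (alone on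
a sphere). -/
noncomputable def numFaces : ℕ :=
  Nat.card (Quotient (Equiv.Perm.SameCycle.setoid ρ.facePerm)) +
    Nat.card {v : V // ∀ w, ¬ G.Adj v w}

/-- `|V| - |E| + |F|`: the sum of the Euler characteristics of the surfaces that carry the
components. -/
noncomputable def eulerChar : ℤ :=
  (Nat.card V : ℤ) - (Nat.card G.edgeSet : ℤ) + (ρ.numFaces : ℤ)

end RotationSystem

/-- A finite graph is toroidal if it can be embedded in the torus (planar graphs included): it has
a rotation system of total genus at most one. If the components are 2-cell embedded in surfaces of
genus `g₁, …, g_c`, then `|V| - |E| + |F| = ∑ (2 - 2 gᵢ) = 2 c - 2 ∑ gᵢ`. -/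
def IsToroidal {V : Type*} (G : SimpleGraph V) : Prop :=
  ∃ ρ : RotationSystem G, 2 * (Nat.card G.ConnectedComponent : ℤ) - 2 ≤ ρ.eulerChar

/-- A graph is `d`-degenerate if every (nonempty) subgraph has a vertex of degree at most `d`. -/
def IsDegenerate {V : Type*} (d : ℕ) (G : SimpleGraph V) : Prop :=
  ∀ K : G.Subgraph, K.verts.Nonempty → ∃ v ∈ K.verts, (K.neighborSet v).encard ≤ d

/-- `G` is `(d, h)`-decomposable if it has a subgraph `H` of maximum degree at most `h` such that
`G - E(H)` is `d`-degenerate. -/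
def IsDecomposable {V : Type*} (d h : ℕ) (G : SimpleGraph V) : Prop :=
  ∃ H : G.Subgraph, (∀ v ∈ H.verts, (H.neighborSet v).encard ≤ h) ∧
    IsDegenerate d (G.deleteEdges H.edgeSet)

/-- A 4-cycle `0 1 2 3` with a chord. -/
def chordedC4 : SimpleGraph (Fin 4) :=
  SimpleGraph.fromEdgeSet {s(0, 1), s(1, 2), s(2, 3), s(3, 0), s(0, 2)}

/-- A 5-cycle `0 1 2 3 4` with a chord. -/
def chordedC5 : SimpleGraph (Fin 5) :=
  SimpleGraph.fromEdgeSet {s(0, 1), s(1, 2), s(2, 3), s(3, 4), s(4, 0), s(0, 2)}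

/-- A 6-cycle `0 1 2 3 4 5` with a chord joining two opposite vertices. -/
def chordedC6 : SimpleGraph (Fin 6) :=
  SimpleGraph.fromEdgeSet
    {s(0, 1), s(1, 2), s(2, 3), s(3, 4), s(4, 5), s(5, 0), s(0, 3)}

/-- A 6-cycle `0 1 2 3 4 5` with a triangle `0 1 6` attached on the edge `0 1`. -/
def triangleOnC6 : SimpleGraph (Fin 7) :=
  SimpleGraph.fromEdgeSet
    {s(0, 1), s(1, 2), s(2, 3), s(3, 4), s(4, 5), s(5, 0), s(0, 6), s(6, 1)}

/-- A 5-cycle `0 1 2 3 4` with a triangle `1 2 5` and a 4-cycle `0 1 6 7` attached on the two edges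
`1 2` and `0 1`, which share a vertex. -/
def triangleSquareOnC5Adj : SimpleGraph (Fin 8) :=
  SimpleGraph.fromEdgeSet
    {s(0, 1), s(1, 2), s(2, 3), s(3, 4), s(4, 0), s(1, 5), s(5, 2), s(1, 6), s(6, 7), s(7, 0)}

/-- A 5-cycle `0 1 2 3 4` with a triangle `2 3 5` and a 4-cycle `0 1 6 7` attached on the two edges
`2 3` and `0 1`, which share no vertex. -/
def triangleSquareOnC5Disj : SimpleGraph (Fin 8) :=
  SimpleGraph.fromEdgeSet
    {s(0, 1), s(1, 2), s(2, 3), s(3, 4), s(4, 0), s(2, 5), s(5, 3), s(1, 6), s(6, 7), s(7, 0)}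

/-- `G` has no (not necessarily induced) subgraph isomorphic to one of the six configurations. -/
def AvoidsConfigurations {V : Type*} (G : SimpleGraph V) : Prop :=
  chordedC4.Free G ∧ chordedC5.Free G ∧ chordedC6.Free G ∧ triangleOnC6.Free G ∧
    triangleSquareOnC5Adj.Free G ∧ triangleSquareOnC5Disj.Free G

/-- `G` contains no cycle of length `l`. -/
def HasNoCycleOfLength {V : Type*} (l : ℕ) (G : SimpleGraph V) : Prop :=
  ∀ (v : V) (c : G.Walk v v), c.IsCycle → c.length ≠ l

end ToroidalDecomposition

/-! The proof is a discharging argument. Decomposability is shown for all induced subgraphs by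
induction on the vertex set. Suppose some distinct vertices are listed and partially matched so that
each has at most two neighbours other than its partner and the later vertices of the list. Then any
decomposition of the remaining graph extends to them (`ReducibleSequence.decomposableOn`). A vertex
of degree at most 2 is such a list, so it remains to refute a graph of minimum degree 3 that admits
no such list. In it, vertices of degree 3 are pairwise nonadjacent, and the `hasReducible_of_...`
lemmas exclude larger patterns of vertices of degree 3 and 4.

Induced subgraphs of a toroidal graph are toroidal (`IsToroidal.anti`), so Euler's formula applies
to them. Written over darts (`sum_curvature_nonneg`), it says that the charges 6(deg - 4) of
vertices and 6(length - 4) of faces have total at most 0. By (a)-(c), two faces of length at most 4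
never share an edge. By (d), triangles do not border 6-faces. With (d)-(f) as well, a 5-face
bordering a triangle borders no other face of length at most 4. A vertex of degree 3 receives 6 from
its faces of length at least 5, a triangle receives 2 across each edge, and a vertex of degree at
least 5 gives 1 at each of its corners. Summed over each vertex and each face, the final charges are
nonnegative, hence all zero (`charges_eq_zero`).

Equality forces degrees at most 4 and faces of length 4 or 5 only, where every 5-face has two
vertices of degree 3, each also on a 4-face. Around such a vertex lie one 4-face and two 5-faces.
These contain a reducible list (`not_hub`), a contradiction (`not_isObstruction`). -/

namespace ToroidalDecomposition

/-! ### Forbidden configurations and the cycles inside them -/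

section Configurations

variable {V : Type*} {G : SimpleGraph V}

theorem fromEdgeSet_isContained {n : ℕ} {s : Set (Sym2 (Fin n))} {W : Type*} {K : SimpleGraph W}
    (f : Fin n → W) (hf : (List.ofFn f).Nodup)
    (h : ∀ e ∈ s, Sym2.map f e ∈ K.edgeSet) : (SimpleGraph.fromEdgeSet s).IsContained K := by
  refine ⟨⟨⟨f, ?_⟩, List.nodup_ofFn.1 hf⟩⟩
  intro a b hab
  exact h _ ((SimpleGraph.fromEdgeSet_adj s).1 hab).1

theorem chordedC4_free_elim (h : chordedC4.Free G) {a b c d : V} (hab : G.Adj a b)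
    (hbc : G.Adj b c) (hcd : G.Adj c d) (hda : G.Adj d a) (hac : G.Adj a c) (hbd : b ≠ d) :
    False := by
  refine h (fromEdgeSet_isContained ![a, b, c, d] ?_ ?_)
  · have := hab.ne; have := hbc.ne; have := hcd.ne; have := hda.ne; have := hac.ne
    simp [List.ofFn_succ]
    grind
  · simp [*]

theorem chordedC5_free_elim (h : chordedC5.Free G) {a b c d e : V} (hn : [a, b, c, d, e].Nodup)
    (hab : G.Adj a b) (hbc : G.Adj b c) (hcd : G.Adj c d) (hde : G.Adj d e) (hea : G.Adj e a)
    (hac : G.Adj a c) : False := by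
  refine h (fromEdgeSet_isContained ![a, b, c, d, e] ?_ ?_)
  · simpa [List.ofFn_succ] using hn
  · simp [*]

theorem chordedC6_free_elim (h : chordedC6.Free G) {a b c d e f : V}
    (hn : [a, b, c, d, e, f].Nodup)
    (hab : G.Adj a b) (hbc : G.Adj b c) (hcd : G.Adj c d) (hde : G.Adj d e) (hef : G.Adj e f)
    (hfa : G.Adj f a) (had : G.Adj a d) : False := by
  refine h (fromEdgeSet_isContained ![a, b, c, d, e, f] ?_ ?_)
  · simpa [List.ofFn_succ] using hn
  · simp [*]

theorem triangleOnC6_free_elim (h : triangleOnC6.Free G) {a b c d e f x : V}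
    (hn : [a, b, c, d, e, f, x].Nodup)
    (hab : G.Adj a b) (hbc : G.Adj b c) (hcd : G.Adj c d) (hde : G.Adj d e) (hef : G.Adj e f)
    (hfa : G.Adj f a) (hax : G.Adj a x) (hxb : G.Adj x b) : False := by
  refine h (fromEdgeSet_isContained ![a, b, c, d, e, f, x] ?_ ?_)
  · simpa [List.ofFn_succ] using hn
  · simp [*]

theorem triangleSquareOnC5Adj_free_elim (h : triangleSquareOnC5Adj.Free G) {a b c d e x y z : V}
    (hn : [a, b, c, d, e, x, y, z].Nodup)
    (hab : G.Adj a b) (hbc : G.Adj b c) (hcd : G.Adj c d) (hde : G.Adj d e) (hea : G.Adj e a)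
    (hbx : G.Adj b x) (hxc : G.Adj x c) (hby : G.Adj b y) (hyz : G.Adj y z) (hza : G.Adj z a) :
    False := by
  refine h (fromEdgeSet_isContained ![a, b, c, d, e, x, y, z] ?_ ?_)
  · simpa [List.ofFn_succ] using hn
  · simp [*]

theorem triangleSquareOnC5Disj_free_elim (h : triangleSquareOnC5Disj.Free G) {a b c d e x y z : V}
    (hn : [a, b, c, d, e, x, y, z].Nodup)
    (hab : G.Adj a b) (hbc : G.Adj b c) (hcd : G.Adj c d) (hde : G.Adj d e) (hea : G.Adj e a)
    (hcx : G.Adj c x) (hxd : G.Adj x d) (hby : G.Adj b y) (hyz : G.Adj y z) (hza : G.Adj z a) :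
    False := by
  refine h (fromEdgeSet_isContained ![a, b, c, d, e, x, y, z] ?_ ?_)
  · simpa [List.ofFn_succ] using hn
  · simp [*]

theorem AvoidsConfigurations.anti {G' : SimpleGraph V} (hle : G' ≤ G)
    (h : AvoidsConfigurations G) : AvoidsConfigurations G' :=
  ⟨fun k => h.1 (k.mono_right hle), fun k => h.2.1 (k.mono_right hle),
    fun k => h.2.2.1 (k.mono_right hle), fun k => h.2.2.2.1 (k.mono_right hle),
    fun k => h.2.2.2.2.1 (k.mono_right hle), fun k => h.2.2.2.2.2 (k.mono_right hle)⟩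

theorem cycleGraph_isContained_of_adj {n : ℕ} [NeZero n] {W : Type*} {K : SimpleGraph W}
    (f : Fin n → W) (hf : (List.ofFn f).Nodup) (h : ∀ i, K.Adj (f i) (f (i + 1))) :
    (SimpleGraph.cycleGraph n).IsContained K := by
  refine ⟨⟨⟨f, ?_⟩, List.nodup_ofFn.1 hf⟩⟩
  intro a b hab
  obtain ⟨m, rfl⟩ : ∃ m, n = m + 1 := ⟨n - 1, by have := NeZero.ne n; omega⟩
  cases m with
  | zero => exact absurd (Fin.ext (by omega)) hab.ne
  | succ m =>
    rcases SimpleGraph.cycleGraph_adj.1 hab with h1 | h1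
    · have := h b
      rw [← h1, add_sub_cancel] at this
      exact this.symm
    · have := h a
      rwa [← h1, add_sub_cancel] at this

theorem HasNoCycleOfLength.free {n : ℕ} (hn : 2 < n) (h : HasNoCycleOfLength n G) {W : Type*}
    {K : SimpleGraph W} (hK : (SimpleGraph.cycleGraph n).IsContained K) : K.Free G := by
  intro hKG
  obtain ⟨v, p, hp, hl⟩ := (SimpleGraph.cycleGraph_isContained_iff hn).1 (hK.trans hKG)
  exact h v p hp hl

/-- Graphs (a), (b), (e), (f) contain cycles of lengths 3 and 4, graph (c) of lengths 4 and 6, graph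
(d) of lengths 3, 6 and 7. Each of the four pairs meets all of these sets of lengths. -/
theorem avoidsConfigurations_of_hasNoCycleOfLength {i j : ℕ}
    (hij : (i, j) ∈ ({(3, 4), (3, 6), (4, 6), (4, 7)} : Set (ℕ × ℕ)))
    (hi : HasNoCycleOfLength i G) (hj : HasNoCycleOfLength j G) : AvoidsConfigurations G := by
  have a3 : (SimpleGraph.cycleGraph 3).IsContained chordedC4 :=
    cycleGraph_isContained_of_adj ![0, 1, 2] (by decide) (by simp [chordedC4, Fin.forall_fin_succ])
  have a4 : (SimpleGraph.cycleGraph 4).IsContained chordedC4 :=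
    cycleGraph_isContained_of_adj ![0, 1, 2, 3] (by decide)
      (by simp [chordedC4, Fin.forall_fin_succ])
  have b3 : (SimpleGraph.cycleGraph 3).IsContained chordedC5 :=
    cycleGraph_isContained_of_adj ![0, 1, 2] (by decide) (by simp [chordedC5, Fin.forall_fin_succ])
  have b4 : (SimpleGraph.cycleGraph 4).IsContained chordedC5 :=
    cycleGraph_isContained_of_adj ![0, 2, 3, 4] (by decide)
      (by simp [chordedC5, Fin.forall_fin_succ])
  have c4 : (SimpleGraph.cycleGraph 4).IsContained chordedC6 :=
    cycleGraph_isContained_of_adj ![0, 1, 2, 3] (by decide)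
      (by simp [chordedC6, Fin.forall_fin_succ])
  have c6 : (SimpleGraph.cycleGraph 6).IsContained chordedC6 :=
    cycleGraph_isContained_of_adj ![0, 1, 2, 3, 4, 5] (by decide)
      (by simp [chordedC6, Fin.forall_fin_succ])
  have d3 : (SimpleGraph.cycleGraph 3).IsContained triangleOnC6 :=
    cycleGraph_isContained_of_adj ![0, 1, 6] (by decide)
      (by simp [triangleOnC6, Fin.forall_fin_succ])
  have d6 : (SimpleGraph.cycleGraph 6).IsContained triangleOnC6 :=
    cycleGraph_isContained_of_adj ![0, 1, 2, 3, 4, 5] (by decide)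
      (by simp [triangleOnC6, Fin.forall_fin_succ])
  have d7 : (SimpleGraph.cycleGraph 7).IsContained triangleOnC6 :=
    cycleGraph_isContained_of_adj ![0, 6, 1, 2, 3, 4, 5] (by decide)
      (by simp [triangleOnC6, Fin.forall_fin_succ])
  have e3 : (SimpleGraph.cycleGraph 3).IsContained triangleSquareOnC5Adj :=
    cycleGraph_isContained_of_adj ![1, 5, 2] (by decide)
      (by simp [triangleSquareOnC5Adj, Fin.forall_fin_succ])
  have e4 : (SimpleGraph.cycleGraph 4).IsContained triangleSquareOnC5Adj :=
    cycleGraph_isContained_of_adj ![0, 1, 6, 7] (by decide)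
      (by simp [triangleSquareOnC5Adj, Fin.forall_fin_succ])
  have f3 : (SimpleGraph.cycleGraph 3).IsContained triangleSquareOnC5Disj :=
    cycleGraph_isContained_of_adj ![2, 5, 3] (by decide)
      (by simp [triangleSquareOnC5Disj, Fin.forall_fin_succ])
  have f4 : (SimpleGraph.cycleGraph 4).IsContained triangleSquareOnC5Disj :=
    cycleGraph_isContained_of_adj ![0, 1, 6, 7] (by decide)
      (by simp [triangleSquareOnC5Disj, Fin.forall_fin_succ])
  simp only [Set.mem_insert_iff, Set.mem_singleton_iff, Prod.mk.injEq] at hij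
  rcases hij with ⟨rfl, rfl⟩ | ⟨rfl, rfl⟩ | ⟨rfl, rfl⟩ | ⟨rfl, rfl⟩
  · exact ⟨hi.free (by simp) a3, hi.free (by simp) b3, hj.free (by simp) c4, hi.free (by simp) d3,
      hi.free (by simp) e3, hi.free (by simp) f3⟩
  · exact ⟨hi.free (by simp) a3, hi.free (by simp) b3, hj.free (by simp) c6, hi.free (by simp) d3,
      hi.free (by simp) e3, hi.free (by simp) f3⟩
  · exact ⟨hi.free (by simp) a4, hi.free (by simp) b4, hi.free (by simp) c4, hj.free (by simp) d6,
      hi.free (by simp) e4, hi.free (by simp) f4⟩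
  · exact ⟨hi.free (by simp) a4, hi.free (by simp) b4, hi.free (by simp) c4, hj.free (by simp) d7,
      hi.free (by simp) e4, hi.free (by simp) f4⟩

end Configurations

/-! ### Reducible sequences and the induction on the vertex set -/

section Reduction

variable {V : Type*}

/-- The number of neighbours of a vertex. -/
noncomputable def valency (G : SimpleGraph V) (v : V) : ℕ := (G.neighborSet v).ncard

/-- The spanning subgraph of `G` formed by the edges with both ends in `A`. -/
def restrictTo (G : SimpleGraph V) (A : Set V) : SimpleGraph V where
  Adj v w := G.Adj v w ∧ v ∈ A ∧ w ∈ A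
  symm := ⟨fun _ _ h => ⟨h.1.symm, h.2.2, h.2.1⟩⟩
  loopless := ⟨fun _ h => h.1.ne rfl⟩

theorem restrictTo_le (G : SimpleGraph V) (A : Set V) : restrictTo G A ≤ G := fun _ _ h => h.1

/-- The vertices in `A` induce a subgraph that becomes 2-degenerate when a matching is deleted. -/
def DecomposableOn (G : SimpleGraph V) (A : Set V) : Prop :=
  ∃ M : SimpleGraph V, M ≤ G ∧ (∀ a b c, M.Adj a b → M.Adj a c → b = c) ∧
    (∀ a b, M.Adj a b → a ∈ A) ∧
    ∀ K ⊆ A, K.Nonempty → ∃ v ∈ K, {w ∈ K | G.Adj v w ∧ ¬ M.Adj v w}.ncard ≤ 2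

/-- A sequence `x` of distinct vertices, partially matched by the involution `m`, in
which every vertex has at most two neighbours apart from its partner and some later vertices `L`
of the sequence. Any decomposition of the remaining graph extends to such a sequence. -/
structure ReducibleSequence (G : SimpleGraph V) {n : ℕ} (x : Fin n → V) (m : Fin n → Fin n)
    (L : Fin n → Finset (Fin n)) : Prop where
  nodup : (List.ofFn x).Nodup
  invol : ∀ i, m (m i) = i
  adj : ∀ i, m i ≠ i → G.Adj (x i) (x (m i))
  later : ∀ i, ∀ j ∈ L i, j = m i ∨ i < j
  adj_later : ∀ i, ∀ j ∈ L i, G.Adj (x i) (x j)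
  valency_le : ∀ i, valency G (x i) ≤ 2 + (L i).card

/-- The graph has a nonempty reducible sequence. -/
def HasReducible (G : SimpleGraph V) : Prop :=
  ∃ (n : ℕ) (x : Fin (n + 1) → V) (m : Fin (n + 1) → Fin (n + 1))
    (L : Fin (n + 1) → Finset (Fin (n + 1))), (∀ i, (L i).Nonempty) ∧ ReducibleSequence G x m L

/-- The pairs `x i`, `x (m i)` are added to the matching. In a set `K` that meets the sequence,
consider the last `x i` in `K`. The later vertices of `L i` are outside `K` and the partner is
joined by a matching edge, so at most two neighbours count. A set that misses the sequence is
handled by the old decomposition. -/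
theorem ReducibleSequence.decomposableOn [Finite V] {G : SimpleGraph V} {A : Set V} {n : ℕ}
    {x : Fin n → V} {m : Fin n → Fin n} {L : Fin n → Finset (Fin n)}
    (h : ReducibleSequence (restrictTo G A) x m L) (hA : ∀ i, x i ∈ A)
    (hd : DecomposableOn G (A \ Set.range x)) : DecomposableOn G A := by
  classical
  have hx : Function.Injective x := List.nodup_ofFn.1 h.nodup
  obtain ⟨M, hMG, hMm, hMA, hMK⟩ := hd
  let M' : SimpleGraph V :=
    { Adj := fun a b => M.Adj a b ∨ ∃ i, m i ≠ i ∧ a = x i ∧ b = x (m i)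
      symm := by
        refine ⟨?_⟩
        rintro a b (hab | ⟨i, hi, rfl, rfl⟩)
        · exact Or.inl hab.symm
        · exact Or.inr ⟨m i, by rw [h.invol]; exact hi.symm, rfl, by rw [h.invol]⟩
      loopless := by
        refine ⟨?_⟩
        rintro a (ha | ⟨i, hi, rfl, h2⟩)
        · exact ha.ne rfl
        · exact hi (hx h2).symm }
  have hnot : ∀ i b, ¬ M.Adj (x i) b := fun i b hb => (hMA _ _ hb).2 ⟨i, rfl⟩
  refine ⟨M', ?_, ?_, ?_, ?_⟩
  · rintro a b (hab | ⟨i, hi, rfl, rfl⟩)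
    · exact hMG hab
    · exact (h.adj i hi).1
  · rintro a b c (hab | ⟨i, hi, rfl, rfl⟩) (hac | ⟨k, hk, hk1, rfl⟩)
    · exact hMm a b c hab hac
    · subst hk1; exact absurd hab (hnot _ _)
    · exact absurd hac (hnot _ _)
    · rw [hx hk1]
  · rintro a b (hab | ⟨i, hi, rfl, rfl⟩)
    · exact (hMA _ _ hab).1
    · exact hA i
  · intro K hKA hK
    by_cases hdis : ∃ i, x i ∈ K
    · let I : Finset (Fin n) := Finset.univ.filter fun i => x i ∈ K
      have hI : I.Nonempty := by
        obtain ⟨i, hi⟩ := hdis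
        exact ⟨i, by simp [I, hi]⟩
      obtain ⟨i, hiI, himax⟩ := I.exists_max_image id hI
      have hiK : x i ∈ K := (Finset.mem_filter.1 hiI).2
      refine ⟨x i, hiK, ?_⟩
      have hsub : {w ∈ K | G.Adj (x i) w ∧ ¬ M'.Adj (x i) w} ⊆
          (restrictTo G A).neighborSet (x i) \ (x '' (L i : Set (Fin n))) := by
        rintro w ⟨hwK, hw, hwM⟩
        refine ⟨⟨hw, hA i, hKA hwK⟩, ?_⟩
        rintro ⟨j, hj, rfl⟩
        rcases h.later i j hj with rfl | hlt
        · refine hwM (Or.inr ⟨i, ?_, rfl, rfl⟩)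
          intro hmi
          rw [hmi] at hw
          exact hw.ne rfl
        · exact absurd (himax j (by simp [I, hwK])) (not_le.2 hlt)
      have h1 := Set.ncard_le_ncard hsub (Set.toFinite _)
      have hsub2 : x '' (L i : Set (Fin n)) ⊆ (restrictTo G A).neighborSet (x i) := by
        rintro _ ⟨j, hj, rfl⟩
        exact h.adj_later i j hj
      have h2 := Set.ncard_sdiff_add_ncard_of_subset hsub2 (Set.toFinite _)
      have h3 : (x '' (L i : Set (Fin n))).ncard = (L i).card := by
        rw [Set.ncard_image_of_injective _ hx, Set.ncard_coe_finset]
      have h4 := h.valency_le i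
      unfold valency at h4
      omega
    · push Not at hdis
      obtain ⟨v, hv, hcard⟩ := hMK K (fun w hw => ⟨hKA hw, by
        rintro ⟨i, rfl⟩
        exact hdis i hw⟩) hK
      refine ⟨v, hv, le_trans (Set.ncard_le_ncard ?_ (Set.toFinite _)) hcard⟩
      rintro w ⟨hw, hvw, hM⟩
      exact ⟨hw, hvw, fun h' => hM (Or.inl h')⟩

theorem isDecomposable_of_hasReducible [Finite V] (G : SimpleGraph V)
    (hred : ∀ A : Set V, A.Nonempty → (∀ v ∈ A, 3 ≤ valency (restrictTo G A) v) →
      HasReducible (restrictTo G A)) : IsDecomposable 2 1 G := by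
  have key : ∀ k : ℕ, ∀ A : Set V, A.ncard = k → DecomposableOn G A := by
    intro k
    induction k using Nat.strong_induction_on with
    | _ k ih =>
      intro A hAk
      rcases A.eq_empty_or_nonempty with rfl | hne
      · exact ⟨⊥, bot_le, by simp, by simp, fun K hK hKne => by
          obtain ⟨v, hv⟩ := hKne
          exact absurd (hK hv) (by simp)⟩
      have step : ∀ {n : ℕ} {x : Fin (n + 1) → V} {m : Fin (n + 1) → Fin (n + 1)}
          {L : Fin (n + 1) → Finset (Fin (n + 1))},
          ReducibleSequence (restrictTo G A) x m L → (∀ i, x i ∈ A) → DecomposableOn G A := by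
        intro n x m L hs hA
        refine hs.decomposableOn hA (ih _ ?_ _ rfl)
        rw [← hAk]
        refine Set.ncard_lt_ncard ⟨Set.sdiff_subset, fun hsub => ?_⟩ (Set.toFinite _)
        exact (hsub (hA 0)).2 ⟨0, rfl⟩
      by_cases hdeg : ∀ v ∈ A, 3 ≤ valency (restrictTo G A) v
      · obtain ⟨n, x, m, L, hL, hs⟩ := hred A hne hdeg
        refine step hs fun i => ?_
        -- A nonempty `L i` provides an edge of `restrictTo G A` at `x i`, which puts `x i` in `A`.
        obtain ⟨j, hj⟩ := hL i
        exact (hs.adj_later i j hj).2.1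
      · push Not at hdeg
        obtain ⟨v, hv, hlt⟩ := hdeg
        -- A vertex of degree at most 2 forms a sequence by itself, unmatched and with no later
        -- neighbours.
        refine step (n := 0) (x := fun _ => v) (m := id) (L := fun _ => ∅)
          ⟨by simp, by simp, by simp, by simp, by simp, fun _ => ?_⟩ fun _ => hv
        simp
        omega
  obtain ⟨M, hMG, hMm, -, hMK⟩ := key _ Set.univ rfl
  refine ⟨⟨Set.univ, M.Adj, fun h => hMG h, fun _ => Set.mem_univ _, M.symm⟩, ?_, ?_⟩
  · intro v _
    refine Set.encard_le_one_iff.2 fun a b ha hb => ?_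
    exact hMm v a b ha hb
  · intro K hK
    obtain ⟨v, hv, hcard⟩ := hMK K.verts (Set.subset_univ _) hK
    refine ⟨v, hv, ?_⟩
    have hsub : K.neighborSet v ⊆ {w ∈ K.verts | G.Adj v w ∧ ¬ M.Adj v w} := by
      intro w hw
      have hw' : K.Adj v w := hw
      have := K.adj_sub hw'
      rw [SimpleGraph.deleteEdges_adj] at this
      exact ⟨K.edge_vert hw'.symm, this.1, fun hM => this.2 hM⟩
    have h1 := Set.encard_le_encard hsub
    rw [← (Set.toFinite {w ∈ K.verts | G.Adj v w ∧ ¬ M.Adj v w}).cast_ncard_eq] at h1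
    exact h1.trans (by exact_mod_cast hcard)

variable {G : SimpleGraph V}

theorem hasReducible_of_adj {u v : V} (huv : G.Adj u v) (hu : valency G u ≤ 3)
    (hv : valency G v ≤ 3) : HasReducible G := by
  -- Here and in the lists below, a vertex of degree at most 3 needs one entry in its set `L i` and
  -- a vertex of degree at most 4 needs two: the partner, if any, and later neighbours.
  refine ⟨1, ![u, v], ![1, 0], ![{1}, {0}], by decide, ?_, by decide, ?_, by decide, ?_, ?_⟩
  · simpa using huv.ne
  · simp [Fin.forall_fin_succ, huv, huv.symm]
  · simp [Fin.forall_fin_succ, huv, huv.symm]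
  · simp [Fin.forall_fin_succ, hu, hv]

/-- A 4-cycle whose degrees are alternately at most 3 and at most 4. -/
theorem hasReducible_of_C4 {a b c d : V} (hn : [a, b, c, d].Nodup) (hab : G.Adj a b)
    (hbc : G.Adj b c) (hcd : G.Adj c d) (hda : G.Adj d a) (ha : valency G a ≤ 3)
    (hb : valency G b ≤ 4) (hc : valency G c ≤ 3) (hd : valency G d ≤ 4) : HasReducible G := by
  refine ⟨3, ![b, d, a, c], ![2, 3, 0, 1], ![{2, 3}, {2, 3}, {0}, {1}], by decide, ?_, by decide,
    ?_, by decide, ?_, ?_⟩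
  · simp [List.ofFn_succ] at hn ⊢
    grind
  all_goals simp [Fin.forall_fin_succ, hab, hbc, hcd, hda, hab.symm, hbc.symm, hcd.symm, hda.symm,
    ha, hb, hc, hd]

/-- A triangle `a b x` and an edge `b c` with all degrees at most 4, where `a` and `c` have degree
at most 3. -/
theorem hasReducible_of_triangleOnC5_ac {a b c x : V} (hn : [a, b, c, x].Nodup)
    (hab : G.Adj a b) (hbc : G.Adj b c) (hax : G.Adj a x) (hxb : G.Adj x b)
    (ha : valency G a ≤ 3) (hb : valency G b ≤ 4) (hc : valency G c ≤ 3) (hx : valency G x ≤ 4) :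
    HasReducible G := by
  refine ⟨3, ![c, x, b, a], ![2, 3, 0, 1], ![{2}, {2, 3}, {0, 3}, {1}], by decide, ?_, by decide,
    ?_, by decide, ?_, ?_⟩
  · simp [List.ofFn_succ] at hn ⊢
    grind
  all_goals simp [Fin.forall_fin_succ, hab, hbc, hax, hxb, hab.symm, hbc.symm, hax.symm, hxb.symm,
    ha, hb, hc, hx]

/-- A 5-cycle `a b c d e` and a triangle `a b x` with all degrees at most 4, where `a` and `d` have
degree at most 3. -/
theorem hasReducible_of_triangleOnC5_ad {a b c d e x : V} (hn : [a, b, c, d, e, x].Nodup)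
    (hab : G.Adj a b) (hbc : G.Adj b c) (hcd : G.Adj c d) (hde : G.Adj d e) (hea : G.Adj e a)
    (hax : G.Adj a x) (hxb : G.Adj x b) (ha : valency G a ≤ 3) (hb : valency G b ≤ 4)
    (hc : valency G c ≤ 4) (hd : valency G d ≤ 3) (he : valency G e ≤ 4) (hx : valency G x ≤ 4) :
    HasReducible G := by
  refine ⟨5, ![x, b, c, e, d, a], ![5, 2, 1, 4, 3, 0],
    ![{5, 1}, {2, 5}, {1, 4}, {4, 5}, {3}, {0}], by decide, ?_, by decide, ?_, by decide, ?_, ?_⟩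
  · simp [List.ofFn_succ] at hn ⊢
    grind
  all_goals simp [Fin.forall_fin_succ, hab, hbc, hcd, hde, hea, hax, hxb, hab.symm, hbc.symm,
    hcd.symm, hde.symm, hea.symm, hax.symm, hxb.symm, ha, hb, hc, hd, he, hx]

/-- A 5-cycle `a b c d e` and a triangle `a b x` with all degrees at most 4, where `c` and `e` have
degree at most 3. -/
theorem hasReducible_of_triangleOnC5_ce {a b c d e x : V} (hn : [a, b, c, d, e, x].Nodup)
    (hab : G.Adj a b) (hbc : G.Adj b c) (hcd : G.Adj c d) (hde : G.Adj d e) (hea : G.Adj e a)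
    (hax : G.Adj a x) (hxb : G.Adj x b) (ha : valency G a ≤ 4) (hb : valency G b ≤ 4)
    (hc : valency G c ≤ 3) (hd : valency G d ≤ 4) (he : valency G e ≤ 3) (hx : valency G x ≤ 4) :
    HasReducible G := by
  refine ⟨5, ![x, b, a, d, c, e], ![2, 4, 0, 5, 1, 3],
    ![{2, 1}, {4, 2}, {0, 5}, {5, 4}, {1}, {3}], by decide, ?_, by decide, ?_, by decide, ?_, ?_⟩
  · simp [List.ofFn_succ] at hn ⊢
    grind
  all_goals simp [Fin.forall_fin_succ, hab, hbc, hcd, hde, hea, hax, hxb, hab.symm, hbc.symm,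
    hcd.symm, hde.symm, hea.symm, hax.symm, hxb.symm, ha, hb, hc, hd, he, hx]

/-- A vertex `h` of degree 3 on a 4-cycle `h b a g` and two 5-cycles `h b c d e`, `h e f k g`; all
degrees are at most 4, and each 5-cycle has a second vertex of degree 3. -/
theorem hasReducible_of_hub {h a b c d e f k g : V} (hn : [h, a, b, c, d, e, f, k, g].Nodup)
    (hab : G.Adj a b) (hbc : G.Adj b c) (hcd : G.Adj c d) (hde : G.Adj d e) (hef : G.Adj e f)
    (hfk : G.Adj f k) (hkg : G.Adj k g) (hga : G.Adj g a) (hhb : G.Adj h b) (hhe : G.Adj h e)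
    (hhg : G.Adj h g) (vh : valency G h ≤ 3) (va : valency G a ≤ 4) (vb : valency G b ≤ 4)
    (vc : valency G c ≤ 4) (vd : valency G d ≤ 4) (ve : valency G e ≤ 4) (vf : valency G f ≤ 4)
    (vk : valency G k ≤ 4) (vg : valency G g ≤ 4) (hcd3 : valency G c ≤ 3 ∨ valency G d ≤ 3)
    (hfk3 : valency G f ≤ 3 ∨ valency G k ≤ 3) : HasReducible G := by
  have hn' : [h, a, b, c, d, e, f, k, g].Nodup := hn
  simp only [List.nodup_cons, List.mem_cons, List.not_mem_nil, not_or, or_false] at hn'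
  -- The list has nine vertices, and in all four cases `h` is the unmatched one. Its single entry is
  -- a later neighbour, `e` or `g`.
  rcases hcd3 with h1 | h1 <;> rcases hfk3 with h2 | h2
  · refine ⟨8, ![a, b, k, g, h, e, f, d, c], ![3, 8, 6, 0, 4, 7, 2, 5, 1],
      ![{3, 1}, {8, 4}, {6, 3}, {0, 4}, {5}, {7, 6}, {2}, {5, 8}, {1}], by decide, ?_, by decide,
      ?_, by decide, ?_, ?_⟩
    · simp [List.ofFn_succ]
      grind
    all_goals simp [Fin.forall_fin_succ, hab, hbc, hcd, hde, hef, hfk, hkg, hga, hhb, hhe, hhg,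
      hab.symm, hbc.symm, hcd.symm, hde.symm, hef.symm, hfk.symm, hkg.symm, hga.symm, hhb.symm,
      hhe.symm, hhg.symm, vh, va, vb, vd, ve, vk, vg, h1, h2]
  · refine ⟨8, ![a, b, f, e, h, g, k, d, c], ![5, 8, 6, 7, 4, 0, 2, 3, 1],
      ![{5, 1}, {8, 4}, {6, 3}, {7, 4}, {5}, {0, 6}, {2}, {3, 8}, {1}], by decide, ?_, by decide,
      ?_, by decide, ?_, ?_⟩
    · simp [List.ofFn_succ]
      grind
    all_goals simp [Fin.forall_fin_succ, hab, hbc, hcd, hde, hef, hfk, hkg, hga, hhb, hhe, hhg,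
      hab.symm, hbc.symm, hcd.symm, hde.symm, hef.symm, hfk.symm, hkg.symm, hga.symm, hhb.symm,
      hhe.symm, hhg.symm, vh, va, vb, vd, ve, vf, vg, h1, h2]
  · refine ⟨8, ![a, b, k, g, h, e, f, c, d], ![3, 7, 6, 0, 4, 8, 2, 1, 5],
      ![{3, 1}, {7, 4}, {6, 3}, {0, 4}, {5}, {8, 6}, {2}, {1, 8}, {5}], by decide, ?_, by decide,
      ?_, by decide, ?_, ?_⟩
    · simp [List.ofFn_succ]
      grind
    all_goals simp [Fin.forall_fin_succ, hab, hbc, hcd, hde, hef, hfk, hkg, hga, hhb, hhe, hhg,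
      hab.symm, hbc.symm, hcd.symm, hde.symm, hef.symm, hfk.symm, hkg.symm, hga.symm, hhb.symm,
      hhe.symm, hhg.symm, vh, va, vb, vc, ve, vk, vg, h1, h2]
  · refine ⟨8, ![a, b, f, e, h, g, k, c, d], ![5, 7, 6, 8, 4, 0, 2, 1, 3],
      ![{5, 1}, {7, 4}, {6, 3}, {8, 4}, {5}, {0, 6}, {2}, {1, 8}, {3}], by decide, ?_, by decide,
      ?_, by decide, ?_, ?_⟩
    · simp [List.ofFn_succ]
      grind
    all_goals simp [Fin.forall_fin_succ, hab, hbc, hcd, hde, hef, hfk, hkg, hga, hhb, hhe, hhg,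
      hab.symm, hbc.symm, hcd.symm, hde.symm, hef.symm, hfk.symm, hkg.symm, hga.symm, hhb.symm,
      hhe.symm, hhg.symm, vh, va, vb, vc, ve, vf, vg, h1, h2]

end Reduction

/-! ### Cycles of a permutation multiplied by a transposition -/

section CycleCount

open Equiv Equiv.Perm

variable {D : Type*}

/-- The number of cycles of a permutation, fixed points included. -/
noncomputable def numCycles (f : Perm D) : ℕ := Nat.card (Quotient (SameCycle.setoid f))

theorem sameCycle_eq_of_invariant {β : Type*} {f : Perm D} {h : D → β} (hf : ∀ x, h (f x) = h x)
    {x y : D} (hxy : f.SameCycle x y) : h x = h y := by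
  have hn : ∀ n : ℕ, ∀ z, h ((f ^ n) z) = h z := by
    intro n
    induction n with
    | zero => simp
    | succ n ih => intro z; rw [pow_succ', mul_apply, hf, ih]
  obtain ⟨i, rfl⟩ := hxy
  rcases i with n | n
  · exact (hn n x).symm
  · rw [← hn (n + 1) ((f ^ Int.negSucc n) x), ← mul_apply, zpow_negSucc, mul_inv_cancel,
      one_apply]

theorem sameCycle_of_semiconj {D' : Type*} [Finite D] {f : Perm D} {g : Perm D'} {ι : D' → D}
    (hι : Function.Injective ι) (h : ∀ x, ι (g x) = f (ι x)) {x y : D'}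
    (hxy : f.SameCycle (ι x) (ι y)) : g.SameCycle x y := by
  obtain ⟨n, -, hn⟩ := hxy.exists_pow_eq'
  refine ⟨n, hι ?_⟩
  rw [← hn, zpow_natCast]
  clear hn hxy
  induction n with
  | zero => rfl
  | succ n ih => rw [pow_succ', mul_apply, h, ih, pow_succ', mul_apply]

variable [DecidableEq D]

/-- Cut the point `a` out of its cycle. -/
def cutOut (f : Perm D) (a : D) : Perm D := swap a (f a) * f

theorem cutOut_self (f : Perm D) (a : D) : cutOut f a a = a := by simp [cutOut]

theorem cutOut_apply_of_eq (f : Perm D) {a x : D} (h : f x = a) : cutOut f a x = f a := by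
  simp [cutOut, h]

theorem cutOut_apply_of_ne (f : Perm D) {a x : D} (hx : x ≠ a) (h : f x ≠ a) :
    cutOut f a x = f x := by
  simp [cutOut, swap_apply_of_ne_of_ne h (fun h' => hx (f.injective h'))]

variable [Finite D]

/-- The transposition splits the common cycle. Every cycle of the product lies in a cycle of `f`, so
the cycles of the product map onto those of `f`. This map is not injective, because `a` and `b` get
separated. -/
theorem numCycles_add_one_le_swap_mul {f : Perm D} {a b : D} (hab : a ≠ b)
    (h : f.SameCycle a b) : numCycles f + 1 ≤ numCycles (swap a b * f) := by
  have hq : ∀ x y, f.SameCycle x y →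
      (Quotient.mk (SameCycle.setoid f) x) = Quotient.mk (SameCycle.setoid f) y :=
    fun x y hxy => Quotient.sound hxy
  have hinv : ∀ x, Quotient.mk (SameCycle.setoid f) ((swap a b * f) x) =
      Quotient.mk (SameCycle.setoid f) x := by
    intro x
    have hx : f.SameCycle (f x) x := (sameCycle_apply_left).2 (SameCycle.refl f x)
    rw [mul_apply]
    by_cases h1 : f x = a
    · rw [h1, swap_apply_left]; exact hq _ _ (h.symm.trans (h1 ▸ hx))
    · by_cases h2 : f x = b
      · rw [h2, swap_apply_right]; exact hq _ _ (h.trans (h2 ▸ hx))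
      · rw [swap_apply_of_ne_of_ne h1 h2]; exact hq _ _ hx
  let F : Quotient (SameCycle.setoid (swap a b * f)) → Quotient (SameCycle.setoid f) :=
    Quotient.lift (Quotient.mk (SameCycle.setoid f))
      (fun x y hxy => sameCycle_eq_of_invariant hinv hxy)
  have hsurj : Function.Surjective F := by
    rintro ⟨x⟩
    exact ⟨Quotient.mk _ x, rfl⟩
  refine Nat.succ_le_of_lt (lt_of_not_ge fun hle => ?_)
  have hinj := (hsurj.bijective_of_nat_card_le hle).1
  have hFab : F (Quotient.mk _ a) = F (Quotient.mk _ b) := hq _ _ h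
  have hsame : (swap a b * f).SameCycle a b := Quotient.exact (hinj hFab)
  have hex : ∃ n : ℕ, (f ^ n) a = b := by
    obtain ⟨n, -, hn⟩ := h.exists_pow_eq'
    exact ⟨n, hn⟩
  classical
  set k := Nat.find hex with hk
  have hkb : (f ^ k) a = b := Nat.find_spec hex
  have hmin : ∀ i < k, (f ^ i) a ≠ b := fun i hi => Nat.find_min hex hi
  have hk0 : 0 < k := by
    rcases Nat.eq_zero_or_pos k with h0 | h0
    · rw [h0] at hkb; exact absurd hkb (by simpa using hab)
    · exact h0
  -- With `k` the first time at which `f` takes `a` to `b`, the product runs through `(f ^ i) a` for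
  -- `i < k` and then returns to `a` instead of reaching `b`.
  have hstep : ∀ n : ℕ, ∃ i < k, ((swap a b * f) ^ n) a = (f ^ i) a := by
    intro n
    induction n with
    | zero => exact ⟨0, hk0, rfl⟩
    | succ n ih =>
      obtain ⟨i, hi, hni⟩ := ih
      rw [pow_succ', mul_apply, hni, mul_apply]
      have hs : f ((f ^ i) a) = (f ^ (i + 1)) a := by rw [pow_succ', mul_apply]
      rw [hs]
      rcases Nat.lt_or_ge (i + 1) k with hlt | hge
      · refine ⟨i + 1, hlt, swap_apply_of_ne_of_ne ?_ (hmin _ hlt)⟩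
        intro hcyc
        refine hmin (k - (i + 1)) (by omega) ?_
        conv_lhs => rw [← hcyc, ← mul_apply, ← pow_add]
        rw [Nat.sub_add_cancel hlt.le, hkb]
      · have : i + 1 = k := by omega
        exact ⟨0, hk0, by rw [this, hkb, swap_apply_right]; rfl⟩
  obtain ⟨n, -, hn⟩ := hsame.exists_pow_eq'
  obtain ⟨i, hi, hni⟩ := hstep n
  exact hmin i hi (hni.symm.trans hn)

/-- If `a` and `b` lie on different cycles, the transposition only merges these two. Identifying the
cycle of `b` with that of `a` gives an invariant of the product that misses one cycle at most. -/
theorem numCycles_le_swap_mul_add_one (f : Perm D) (a b : D) :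
    numCycles f ≤ numCycles (swap a b * f) + 1 := by
  classical
  by_cases hs : f.SameCycle a b
  · by_cases hab : a = b
    · subst hab
      rw [swap_self]
      exact Nat.le_succ _
    · have := numCycles_add_one_le_swap_mul hab hs
      omega
  let g : D → Quotient (SameCycle.setoid f) := fun x =>
    if f.SameCycle x b then Quotient.mk _ a else Quotient.mk _ x
  have hgf : ∀ x, g (f x) = g x := by
    intro x
    simp only [g, sameCycle_apply_left]
    split_ifs
    · rfl
    · exact Quotient.sound ((sameCycle_apply_left).2 (SameCycle.refl f x))
  have hga : g a = g b := by simp [g, SameCycle.refl]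
  have hinv : ∀ x, g ((swap a b * f) x) = g x := by
    intro x
    rw [mul_apply, ← hgf x]
    by_cases h1 : f x = a
    · rw [h1, swap_apply_left, hga]
    · by_cases h2 : f x = b
      · rw [h2, swap_apply_right, hga]
      · rw [swap_apply_of_ne_of_ne h1 h2]
  let F : Option (Quotient (SameCycle.setoid (swap a b * f))) → Quotient (SameCycle.setoid f) :=
    fun o => o.elim (Quotient.mk _ b)
      (Quotient.lift g (fun x y hxy => sameCycle_eq_of_invariant hinv hxy))
  have hsurj : Function.Surjective F := by
    rintro ⟨x⟩
    by_cases hx : f.SameCycle x b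
    · exact ⟨none, Quotient.sound hx.symm⟩
    · refine ⟨some (Quotient.mk _ x), ?_⟩
      change g x = _
      simp only [g, if_neg hx]
      rfl
  have := Nat.card_le_card_of_surjective F hsurj
  rwa [Finite.card_option] at this

/-- The new permutation follows `f` and jumps over `a`. -/
theorem sameCycle_cutOut {f : Perm D} {a x y : D} (hx : x ≠ a) (hy : y ≠ a)
    (h : f.SameCycle x y) : (cutOut f a).SameCycle x y := by
  obtain ⟨n, -, rfl⟩ := h.exists_pow_eq'
  have key : ∀ n : ℕ, ((f ^ n) x ≠ a → (cutOut f a).SameCycle x ((f ^ n) x)) ∧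
      ((f ^ n) x = a → (cutOut f a).SameCycle x (f a)) := by
    intro n
    induction n with
    | zero => exact ⟨fun _ => SameCycle.refl _ _, fun h => absurd h hx⟩
    | succ n ih =>
      rw [pow_succ', mul_apply]
      by_cases h1 : (f ^ n) x = a
      · rw [h1]
        exact ⟨fun _ => ih.2 h1, fun _ => ih.2 h1⟩
      · refine ⟨fun h2 => ?_, fun h2 => ?_⟩
        · have := (ih.1 h1).trans ((sameCycle_apply_right).2 (SameCycle.refl _ _))
          rwa [cutOut_apply_of_ne f h1 h2] at this
        · have := (ih.1 h1).trans ((sameCycle_apply_right).2 (SameCycle.refl _ _))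
          rwa [cutOut_apply_of_eq f h2] at this
  exact (key n).1 hy

end CycleCount

/-! ### Subgraphs of toroidal graphs are toroidal -/

section EdgeDeletion

open Equiv Equiv.Perm

variable {V : Type*} {G : SimpleGraph V}

theorem finite_dart [Finite V] (G : SimpleGraph V) : Finite G.Dart :=
  Finite.of_injective (fun d : G.Dart => d.toProd) SimpleGraph.Dart.toProd_injective

theorem reachable_deleteEdges {u v x y : V} (h : G.Reachable x y) :
    (G.deleteEdges {s(u, v)}).Reachable x y ∨
      ((G.deleteEdges {s(u, v)}).Reachable x u ∨ (G.deleteEdges {s(u, v)}).Reachable x v) ∧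
      ((G.deleteEdges {s(u, v)}).Reachable y u ∨ (G.deleteEdges {s(u, v)}).Reachable y v) := by
  obtain ⟨p⟩ := h
  induction p with
  | nil => exact Or.inl (SimpleGraph.Reachable.refl _)
  | @cons a b c hab p ih =>
    by_cases he : s(a, b) = s(u, v)
    · have ha : (G.deleteEdges {s(u, v)}).Reachable a u ∨
          (G.deleteEdges {s(u, v)}).Reachable a v := by
        rcases Sym2.eq_iff.1 he with ⟨rfl, rfl⟩ | ⟨rfl, rfl⟩
        · exact Or.inl (SimpleGraph.Reachable.refl _)
        · exact Or.inr (SimpleGraph.Reachable.refl _)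
      have hb : (G.deleteEdges {s(u, v)}).Reachable b u ∨
          (G.deleteEdges {s(u, v)}).Reachable b v := by
        rcases Sym2.eq_iff.1 he with ⟨rfl, rfl⟩ | ⟨rfl, rfl⟩
        · exact Or.inr (SimpleGraph.Reachable.refl _)
        · exact Or.inl (SimpleGraph.Reachable.refl _)
      rcases ih with h1 | h1
      · exact Or.inr ⟨ha, hb.imp h1.symm.trans h1.symm.trans⟩
      · exact Or.inr ⟨ha, h1.2⟩
    · have hab' : (G.deleteEdges {s(u, v)}).Reachable a b := by
        refine SimpleGraph.Adj.reachable ?_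
        rw [SimpleGraph.deleteEdges_adj]
        exact ⟨hab, he⟩
      rcases ih with h1 | h1
      · exact Or.inl (hab'.trans h1)
      · exact Or.inr ⟨h1.1.imp hab'.trans hab'.trans, h1.2⟩

theorem card_connectedComponent_deleteEdges_le [Finite V] (u v : V) :
    Nat.card (G.deleteEdges {s(u, v)}).ConnectedComponent ≤ Nat.card G.ConnectedComponent + 1 := by
  classical
  set G' := G.deleteEdges {s(u, v)} with hG'
  -- Two components that merge in `G` contain `u` and `v` respectively. Setting the component of `u`
  -- aside therefore leaves an injective map.
  let F : G'.ConnectedComponent → Option G.ConnectedComponent := fun c =>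
    if c = G'.connectedComponentMk u then none
    else some (c.map (SimpleGraph.Hom.ofLE (G.deleteEdges_le _)))
  have hF : Function.Injective F := by
    intro c c' hcc
    induction c using SimpleGraph.ConnectedComponent.ind with | _ x
    induction c' using SimpleGraph.ConnectedComponent.ind with | _ y
    simp only [F] at hcc
    split_ifs at hcc with h1 h2 h2
    · exact h1.trans h2.symm
    · have hxy : G.Reachable x y := SimpleGraph.ConnectedComponent.exact (Option.some.inj hcc)
      rw [SimpleGraph.ConnectedComponent.eq] at h1 h2 ⊢
      rcases reachable_deleteEdges (u := u) (v := v) hxy with h | ⟨h3, h4⟩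
      · exact h
      · exact (h3.resolve_left h1).trans (h4.resolve_left h2).symm
  have := Nat.card_le_card_of_injective F hF
  rwa [Finite.card_option] at this

theorem card_connectedComponent_deleteEdges_le_of_reachable [Finite V] {u v : V}
    (h : (G.deleteEdges {s(u, v)}).Reachable u v) :
    Nat.card (G.deleteEdges {s(u, v)}).ConnectedComponent ≤ Nat.card G.ConnectedComponent := by
  refine Nat.card_le_card_of_injective
    (fun c => c.map (SimpleGraph.Hom.ofLE (G.deleteEdges_le {s(u, v)}))) ?_
  intro c c' hcc
  induction c using SimpleGraph.ConnectedComponent.ind with | _ x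
  induction c' using SimpleGraph.ConnectedComponent.ind with | _ y
  have hxy : G.Reachable x y := SimpleGraph.ConnectedComponent.exact hcc
  rw [SimpleGraph.ConnectedComponent.eq]
  rcases reachable_deleteEdges (u := u) (v := v) hxy with h1 | ⟨h3, h4⟩
  · exact h1
  · have h3' := h3.elim id (fun h' => h'.trans h.symm)
    have h4' := h4.elim id (fun h' => h'.trans h.symm)
    exact h3'.trans h4'.symm

namespace RotationSystem

variable (ρ : RotationSystem G)

theorem facePerm_apply (d : G.Dart) : ρ.facePerm d = ρ.next d.symm := rfl

theorem facePerm_fst (d : G.Dart) : (ρ.facePerm d).fst = d.snd := by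
  rw [facePerm_apply, ρ.next_fst]; rfl

theorem next_ne_of_fst_ne {d e : G.Dart} (h : d.fst ≠ e.fst) : ρ.next d ≠ e := by
  intro h'
  rw [← h', ρ.next_fst] at h
  exact h rfl

/-- The rest of the face of `d`, from `d.snd` until the first return to `d`, is a walk to `d.fst`.
It uses neither `d` nor its reverse. -/
theorem reachable_of_not_sameCycle [Finite V] (d : G.Dart)
    (h : ¬ ρ.facePerm.SameCycle d d.symm) :
    (G.deleteEdges {s(d.fst, d.snd)}).Reachable d.fst d.snd := by
  classical
  have := finite_dart G
  have hex : ∃ n : ℕ, (ρ.facePerm ^ (n + 1)) d = d := by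
    obtain ⟨n, -, hn⟩ := ((sameCycle_apply_left (f := ρ.facePerm)).2
      (SameCycle.refl _ d)).exists_pow_eq'
    exact ⟨n, by rw [pow_succ, mul_apply, hn]⟩
  have key : ∀ i, i ≤ Nat.find hex → (G.deleteEdges {s(d.fst, d.snd)}).Reachable d.snd
      ((ρ.facePerm ^ (i + 1)) d).fst := by
    intro i
    induction i with
    | zero =>
      intro _
      rw [zero_add, pow_one, facePerm_fst]
    | succ i ih =>
      intro hi
      refine (ih (by omega)).trans (SimpleGraph.Adj.reachable ?_)
      have hs : ((ρ.facePerm ^ (i + 1 + 1)) d).fst = ((ρ.facePerm ^ (i + 1)) d).snd := by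
        rw [pow_succ', mul_apply, facePerm_fst]
      rw [hs, SimpleGraph.deleteEdges_adj]
      refine ⟨((ρ.facePerm ^ (i + 1)) d).adj, fun he => ?_⟩
      rcases (SimpleGraph.dart_edge_eq_iff ((ρ.facePerm ^ (i + 1)) d) d).1 he with h1 | h1
      · exact Nat.find_min hex (Nat.lt_of_succ_le hi) h1
      · exact h ⟨(i + 1 : ℕ), by rw [zpow_natCast, h1]⟩
  have := key _ le_rfl
  rw [Nat.find_spec hex] at this
  exact this.symm

theorem not_adj_of_next_eq {d : G.Dart} (h : ρ.next d = d) {w : V} (hw : G.Adj d.fst w) :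
    w = d.snd := by
  obtain ⟨i, hi⟩ := ρ.sameCycle_of_fst_eq d ⟨(d.fst, w), hw⟩ rfl
  rw [zpow_apply_eq_self_of_apply_eq_self h] at hi
  rw [hi]

section Deletion

variable [DecidableEq G.Dart] (d₀ : G.Dart)

/-- The rotation with both darts of the edge of `d₀` cut out. -/
def cutRotation : Perm G.Dart := cutOut (cutOut ρ.next d₀) d₀.symm

theorem cutOut_next_fst {f : Perm G.Dart} (hf : ∀ d, (f d).fst = d.fst) (a d : G.Dart) :
    (cutOut f a d).fst = d.fst := by
  by_cases h1 : d = a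
  · rw [h1, cutOut_self]
  · by_cases h2 : f d = a
    · rw [cutOut_apply_of_eq f h2, hf, ← h2, hf]
    · rw [cutOut_apply_of_ne f h1 h2, hf]

theorem cutRotation_fst (d : G.Dart) : (ρ.cutRotation d₀ d).fst = d.fst :=
  cutOut_next_fst (cutOut_next_fst ρ.next_fst d₀) _ d

theorem cutOut_next_symm : cutOut ρ.next d₀ d₀.symm = ρ.next d₀.symm :=
  cutOut_apply_of_ne _ d₀.symm_ne (ρ.next_ne_of_fst_ne d₀.adj.ne.symm)

theorem cutRotation_symm : ρ.cutRotation d₀ d₀.symm = d₀.symm := cutOut_self _ _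

theorem cutRotation_self : ρ.cutRotation d₀ d₀ = d₀ := by
  have h : cutOut ρ.next d₀ d₀ = d₀ := cutOut_self _ _
  rw [cutRotation, cutOut_apply_of_ne, h]
  · exact d₀.symm_ne.symm
  · rw [h]; exact d₀.symm_ne.symm

theorem cutRotation_eq :
    ρ.cutRotation d₀ = swap d₀.symm (ρ.next d₀.symm) * (swap d₀ (ρ.next d₀) * ρ.next) := by
  rw [cutRotation, cutOut, cutOut_next_symm]; rfl

theorem cutRotation_ne_iff (d : G.Dart) :
    (ρ.cutRotation d₀ d ≠ d₀ ∧ ρ.cutRotation d₀ d ≠ d₀.symm) ↔ (d ≠ d₀ ∧ d ≠ d₀.symm) := by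
  refine and_congr (not_congr ?_) (not_congr ?_)
  · exact ⟨fun h => (ρ.cutRotation d₀).injective (h.trans (ρ.cutRotation_self d₀).symm),
      fun h => by rw [h, cutRotation_self]⟩
  · exact ⟨fun h => (ρ.cutRotation d₀).injective (h.trans (ρ.cutRotation_symm d₀).symm),
      fun h => by rw [h, cutRotation_symm]⟩

/-- The darts that remain after the deletion of an edge. -/
def remainingDarts :
    {d : G.Dart // d ≠ d₀ ∧ d ≠ d₀.symm} ≃ (G.deleteEdges {s(d₀.fst, d₀.snd)}).Dart where
  toFun d := ⟨d.1.toProd, by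
    rw [SimpleGraph.deleteEdges_adj]
    refine ⟨d.1.adj, fun he => ?_⟩
    rcases (SimpleGraph.dart_edge_eq_iff d.1 d₀).1 he with h | h
    · exact d.2.1 h
    · exact d.2.2 h⟩
  invFun d := ⟨⟨d.toProd, (SimpleGraph.deleteEdges_adj.1 d.adj).1⟩, by
    have := (SimpleGraph.deleteEdges_adj.1 d.adj).2
    constructor
    · rintro h
      have h' : d.toProd = d₀.toProd := congrArg SimpleGraph.Dart.toProd h
      exact this (by rw [h']; rfl)
    · rintro h
      refine this ?_
      have h' : d.toProd = d₀.symm.toProd := congrArg SimpleGraph.Dart.toProd h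
      rw [h']
      exact Sym2.eq_swap⟩
  left_inv _ := rfl
  right_inv _ := rfl

/-- The rotation system left by the deletion of an edge. -/
def deleteEdge [Finite V] : RotationSystem (G.deleteEdges {s(d₀.fst, d₀.snd)}) where
  next := (remainingDarts d₀).permCongr
    ((ρ.cutRotation d₀).subtypePerm (p := fun d => d ≠ d₀ ∧ d ≠ d₀.symm)
      (ρ.cutRotation_ne_iff d₀))
  next_fst d := ρ.cutRotation_fst d₀ ((remainingDarts d₀).symm d).1
  sameCycle_of_fst_eq d e h := by
    have := finite_dart G
    refine sameCycle_of_semiconj (f := ρ.cutRotation d₀)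
      (ι := fun d => ((remainingDarts d₀).symm d).1)
      (Subtype.val_injective.comp (remainingDarts d₀).symm.injective) ?_ ?_
    · intro x
      simp [Equiv.permCongr_apply]
    · refine sameCycle_cutOut ?_ ?_ (sameCycle_cutOut ?_ ?_ (ρ.sameCycle_of_fst_eq _ _ h))
      · exact ((remainingDarts d₀).symm d).2.2
      · exact ((remainingDarts d₀).symm e).2.2
      · exact ((remainingDarts d₀).symm d).2.1
      · exact ((remainingDarts d₀).symm e).2.1

theorem deleteEdge_next [Finite V] (d : (G.deleteEdges {s(d₀.fst, d₀.snd)}).Dart) :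
    ((remainingDarts d₀).symm ((ρ.deleteEdge d₀).next d)).1 =
      ρ.cutRotation d₀ ((remainingDarts d₀).symm d).1 := by
  simp [deleteEdge, Equiv.permCongr_apply]

/-- The two cut darts form one cycle of their own, and every other cycle is a face of the smaller
graph. -/
theorem numCycles_cutRotation_le [Finite V] :
    numCycles (ρ.cutRotation d₀ * dartReverse G) ≤ numCycles (ρ.deleteEdge d₀).facePerm + 1 := by
  have := finite_dart G
  have := finite_dart (G.deleteEdges {s(d₀.fst, d₀.snd)})
  set φ := ρ.cutRotation d₀ * dartReverse G with hφ
  set ι := fun d : (G.deleteEdges {s(d₀.fst, d₀.snd)}).Dart => ((remainingDarts d₀).symm d).1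
    with hι
  have hcomm : ∀ x, ι ((ρ.deleteEdge d₀).facePerm x) = φ (ι x) := fun x =>
    ρ.deleteEdge_next d₀ x.symm
  have hinv : ∀ x, Quotient.mk (SameCycle.setoid φ) (ι ((ρ.deleteEdge d₀).facePerm x)) =
      Quotient.mk (SameCycle.setoid φ) (ι x) := by
    intro x
    rw [hcomm]
    exact Quotient.sound ((sameCycle_apply_left).2 (SameCycle.refl _ _))
  let F : Option (Quotient (SameCycle.setoid (ρ.deleteEdge d₀).facePerm)) →
      Quotient (SameCycle.setoid φ) := fun o => o.elim (Quotient.mk _ d₀)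
        (Quotient.lift (fun x => Quotient.mk (SameCycle.setoid φ) (ι x))
          (fun x y hxy => sameCycle_eq_of_invariant (f := (ρ.deleteEdge d₀).facePerm)
            (h := fun x => Quotient.mk (SameCycle.setoid φ) (ι x)) hinv hxy))
  have hsurj : Function.Surjective F := by
    rintro ⟨x⟩
    by_cases h0 : x = d₀
    · exact ⟨none, by rw [h0]; rfl⟩
    by_cases h1 : x = d₀.symm
    · refine ⟨none, Quotient.sound ?_⟩
      have : φ d₀ = x := by rw [h1]; exact ρ.cutRotation_symm d₀
      rw [← this]
      exact (sameCycle_apply_right).2 (SameCycle.refl _ _)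
    · exact ⟨some (Quotient.mk _ (remainingDarts d₀ ⟨x, h0, h1⟩)), rfl⟩
  have := Nat.card_le_card_of_surjective F hsurj
  rwa [Finite.card_option] at this

/-- The indicator that the initial vertex of a dart has no further dart. -/
def pendant (d : G.Dart) : ℕ := if ρ.next d = d then 1 else 0

open Classical in
-- Cutting out the two darts multiplies the face permutation by two transpositions. The first splits
-- a cycle if both darts lie on one face, and otherwise loses at most one cycle. The second always
-- splits a cycle. At a pendant end the transposition is trivial, which `pendant` accounts for.
theorem numCycles_cutRotation_ge [Finite V] :
    numCycles ρ.facePerm + (if ρ.facePerm.SameCycle d₀ d₀.symm then 2 else 0) ≤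
      numCycles (ρ.cutRotation d₀ * dartReverse G) + ρ.pendant d₀ + ρ.pendant d₀.symm := by
  have := finite_dart G
  set φ₁ := swap d₀ (ρ.next d₀) * ρ.facePerm with hφ₁
  have hφ : ρ.cutRotation d₀ * dartReverse G = swap d₀.symm (ρ.next d₀.symm) * φ₁ := by
    rw [cutRotation_eq, hφ₁, facePerm]
    simp only [mul_assoc]
  have hne : ρ.next d₀.symm ≠ d₀ := ρ.next_ne_of_fst_ne d₀.adj.ne.symm
  have hne' : ρ.next d₀.symm ≠ ρ.next d₀ := fun h => d₀.symm_ne (ρ.next.injective h)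
  have hstep : ρ.facePerm d₀.symm = ρ.next d₀ := by
    rw [facePerm_apply, SimpleGraph.Dart.symm_symm]
  have h2 : numCycles φ₁ + 1 ≤ numCycles (ρ.cutRotation d₀ * dartReverse G) +
      ρ.pendant d₀.symm := by
    by_cases hp : ρ.next d₀.symm = d₀.symm
    · rw [hφ, pendant, if_pos hp, hp, swap_self]
      rfl
    · rw [hφ, pendant, if_neg hp, add_zero]
      refine numCycles_add_one_le_swap_mul (Ne.symm hp) ⟨2, ?_⟩
      have e1 : φ₁ d₀.symm = d₀ := by rw [hφ₁, mul_apply, hstep, swap_apply_right]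
      have e2 : φ₁ d₀ = ρ.next d₀.symm := by
        rw [hφ₁, mul_apply, facePerm_apply, swap_apply_of_ne_of_ne hne hne']
      rw [show φ₁ ^ (2 : ℤ) = φ₁ * φ₁ from zpow_two φ₁, mul_apply, e1, e2]
  have h1 : numCycles ρ.facePerm + (if ρ.facePerm.SameCycle d₀ d₀.symm then 2 else 0) ≤
      numCycles φ₁ + 1 + ρ.pendant d₀ := by
    by_cases hp : ρ.next d₀ = d₀
    · rw [hφ₁, pendant, if_pos hp, hp, swap_self]
      change _ ≤ numCycles ρ.facePerm + 1 + 1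
      split_ifs <;> omega
    · rw [pendant, if_neg hp, add_zero]
      split_ifs with hs
      · have hs' : ρ.facePerm.SameCycle d₀ (ρ.next d₀) := by
          rw [← hstep]; exact (sameCycle_apply_right).2 hs
        have := numCycles_add_one_le_swap_mul (Ne.symm hp) hs'
        rw [← hφ₁] at this
        omega
      · exact numCycles_le_swap_mul_add_one _ _ _
  omega

/-- A pendant end becomes isolated. As isolated vertices count as faces, this makes up for the loss
at pendant ends in `numCycles_cutRotation_ge`. -/
theorem card_isolated_deleteEdge [Finite V] :
    Nat.card {v : V // ∀ w, ¬ G.Adj v w} + ρ.pendant d₀ + ρ.pendant d₀.symm ≤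
      Nat.card {v : V // ∀ w, ¬ (G.deleteEdges {s(d₀.fst, d₀.snd)}).Adj v w} := by
  classical
  set G' := G.deleteEdges {s(d₀.fst, d₀.snd)} with hG'
  have hsub : {v : V | ∀ w, ¬ G.Adj v w} ∪ ((if ρ.next d₀ = d₀ then {d₀.fst} else ∅) ∪
      (if ρ.next d₀.symm = d₀.symm then {d₀.snd} else ∅)) ⊆ {v : V | ∀ w, ¬ G'.Adj v w} := by
    rintro v (hv | hv | hv) w hvw
    · exact hv w (SimpleGraph.deleteEdges_adj.1 hvw).1
    · split_ifs at hv with h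
      · obtain rfl : v = d₀.fst := hv
        have := ρ.not_adj_of_next_eq h (SimpleGraph.deleteEdges_adj.1 hvw).1
        subst this
        exact (SimpleGraph.deleteEdges_adj.1 hvw).2 rfl
      · exact hv
    · split_ifs at hv with h
      · obtain rfl : v = d₀.symm.fst := hv
        have := ρ.not_adj_of_next_eq h (SimpleGraph.deleteEdges_adj.1 hvw).1
        subst this
        exact (SimpleGraph.deleteEdges_adj.1 hvw).2 Sym2.eq_swap
      · exact hv
  have hle := Set.ncard_le_ncard hsub (Set.toFinite _)
  rw [Set.ncard_union_eq, Set.ncard_union_eq] at hle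
  · have e1 : (if ρ.next d₀ = d₀ then ({d₀.fst} : Set V) else ∅).ncard = ρ.pendant d₀ := by
      rw [pendant]; split_ifs <;> simp
    have e2 : (if ρ.next d₀.symm = d₀.symm then ({d₀.snd} : Set V) else ∅).ncard =
        ρ.pendant d₀.symm := by
      rw [pendant]; split_ifs <;> simp
    rw [e1, e2, ← Nat.card_coe_set_eq, ← Nat.card_coe_set_eq] at hle
    rw [add_assoc]
    exact hle
  · split_ifs <;> simp [d₀.adj.ne]
  · rw [Set.disjoint_left]
    rintro v hv (hv' | hv')
    · split_ifs at hv' with h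
      · obtain rfl : v = d₀.fst := hv'
        exact hv _ d₀.adj
      · exact hv'
    · split_ifs at hv' with h
      · obtain rfl : v = d₀.snd := hv'
        exact hv _ d₀.adj.symm
      · exact hv'

end Deletion

end RotationSystem

/-- If the edge lies on two faces, at most one face is lost together with the edge, and no component
is gained. If both darts lie on one face, at least one face is gained, so the Euler characteristic
grows by at least 2, enough for one additional component. -/
theorem IsToroidal.deleteEdge [Finite V] (h : IsToroidal G) (d₀ : G.Dart) :
    IsToroidal (G.deleteEdges {s(d₀.fst, d₀.snd)}) := by
  classical
  obtain ⟨ρ, hρ⟩ := h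
  refine ⟨ρ.deleteEdge d₀, ?_⟩
  have h1 := ρ.numCycles_cutRotation_le d₀
  have h2 := ρ.numCycles_cutRotation_ge d₀
  have h3 := ρ.card_isolated_deleteEdge d₀
  have h4 := card_connectedComponent_deleteEdges_le (G := G) d₀.fst d₀.snd
  have h5 : Nat.card (G.deleteEdges {s(d₀.fst, d₀.snd)}).edgeSet + 1 = Nat.card G.edgeSet := by
    rw [Nat.card_coe_set_eq, Nat.card_coe_set_eq, SimpleGraph.edgeSet_deleteEdges]
    exact Set.ncard_sdiff_singleton_add_one d₀.adj (Set.toFinite _)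
  have h6 : ¬ ρ.facePerm.SameCycle d₀ d₀.symm →
      Nat.card (G.deleteEdges {s(d₀.fst, d₀.snd)}).ConnectedComponent ≤
        Nat.card G.ConnectedComponent := fun hs =>
    card_connectedComponent_deleteEdges_le_of_reachable (ρ.reachable_of_not_sameCycle d₀ hs)
  unfold RotationSystem.eulerChar RotationSystem.numFaces at hρ ⊢
  unfold numCycles at h1 h2
  by_cases hs : ρ.facePerm.SameCycle d₀ d₀.symm
  · rw [if_pos hs] at h2
    omega
  · have h6 := h6 hs
    rw [if_neg hs] at h2
    omega

theorem IsToroidal.anti [Finite V] {G' : SimpleGraph V} (hle : G' ≤ G) (h : IsToroidal G) :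
    IsToroidal G' := by
  obtain ⟨k, hk⟩ : ∃ k, (G.edgeSet \ G'.edgeSet).ncard = k := ⟨_, rfl⟩
  induction k generalizing G with
  | zero =>
    rw [Set.ncard_eq_zero (Set.toFinite _), Set.sdiff_eq_empty] at hk
    rwa [le_antisymm hle (SimpleGraph.edgeSet_subset_edgeSet.1 hk)]
  | succ k ih =>
    obtain ⟨e, he, he'⟩ : (G.edgeSet \ G'.edgeSet).Nonempty := by
      rw [← Set.ncard_pos (Set.toFinite _)]; omega
    induction e using Sym2.ind with | _ u v
    refine ih (G := G.deleteEdges {s(u, v)}) ?_ (h.deleteEdge ⟨(u, v), he⟩) ?_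
    · intro a b hab
      rw [SimpleGraph.deleteEdges_adj]
      refine ⟨hle hab, ?_⟩
      rintro h1
      refine he' ?_
      rw [← Set.mem_singleton_iff.1 h1]
      exact hab
    · rw [SimpleGraph.edgeSet_deleteEdges, sdiff_right_comm]
      have := Set.ncard_sdiff_singleton_add_one (a := s(u, v)) (s := G.edgeSet \ G'.edgeSet)
        ⟨he, he'⟩ (Set.toFinite _)
      omega

end EdgeDeletion

/-! ### Cycle lengths and the number of cycles -/

section CycleLength

open Equiv Equiv.Perm

variable {D : Type*}

/-- The length of the cycle of a permutation through a point. -/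
noncomputable def cycleLength (f : Perm D) (x : D) : ℕ := {y | f.SameCycle x y}.ncard

theorem cycleLength_eq_of_sameCycle {f : Perm D} {x y : D} (h : f.SameCycle x y) :
    cycleLength f x = cycleLength f y := by
  unfold cycleLength
  congr 1
  ext z
  exact ⟨h.symm.trans, h.trans⟩

theorem cycleLength_apply (f : Perm D) (x : D) : cycleLength f (f x) = cycleLength f x :=
  cycleLength_eq_of_sameCycle ((sameCycle_apply_left).2 (SameCycle.refl _ _))

variable [Finite D]

theorem pow_apply_eq_self_iff_cycleLength_dvd (f : Perm D) (x : D) (n : ℕ) :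
    (f ^ n) x = x ↔ cycleLength f x ∣ n := by
  classical
  have hfin : {y | f.SameCycle x y}.Finite := Set.toFinite _
  have hcyc : f.IsCycleOn (hfin.toFinset : Set D) := by
    rw [Set.Finite.coe_toFinset]
    refine ⟨⟨fun y hy => (sameCycle_apply_right).2 hy, f.injective.injOn, fun y hy => ?_⟩, ?_⟩
    · refine ⟨f⁻¹ y, ?_, by simp⟩
      exact (sameCycle_apply_right (f := f)).1 (by simpa using hy)
    · intro y hy z hz
      exact hy.symm.trans hz
  rw [hcyc.pow_apply_eq (a := x) (by simp [SameCycle.refl]), cycleLength,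
    Set.ncard_eq_toFinset_card _ hfin]

theorem cycleLength_pos (f : Perm D) (x : D) : 0 < cycleLength f x :=
  (Set.ncard_pos (Set.toFinite _)).2 ⟨x, SameCycle.refl _ _⟩

/-- The points of a cycle of length `l` contribute `1 / l` each, hence 1 together. -/
theorem sum_inv_cycleLength [Fintype D] (f : Perm D) :
    ∑ x, (1 : ℚ) / cycleLength f x = numCycles f := by
  classical
  have hQ : Fintype (Quotient (SameCycle.setoid f)) := Fintype.ofFinite _
  rw [← Finset.sum_fiberwise Finset.univ (fun x => Quotient.mk (SameCycle.setoid f) x), numCycles,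
    Nat.card_eq_fintype_card, ← Finset.card_univ, Finset.cast_card]
  refine Finset.sum_congr rfl fun q _ => ?_
  induction q using Quotient.inductionOn with | _ y
  have hmem : ∀ x, x ∈ Finset.univ.filter
      (fun x => Quotient.mk (SameCycle.setoid f) x = Quotient.mk (SameCycle.setoid f) y) ↔
      f.SameCycle y x := by
    intro x
    rw [Finset.mem_filter, Quotient.eq]
    exact ⟨fun h => SameCycle.symm h.2, fun h => ⟨Finset.mem_univ _, h.symm⟩⟩
  rw [Finset.sum_congr rfl (g := fun _ => (1 : ℚ) / cycleLength f y)
    (fun x hx => by rw [cycleLength_eq_of_sameCycle ((hmem x).1 hx)]), Finset.sum_const,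
    nsmul_eq_mul]
  have hcard : (Finset.univ.filter (fun x => Quotient.mk (SameCycle.setoid f) x =
      Quotient.mk (SameCycle.setoid f) y)).card = cycleLength f y := by
    rw [cycleLength, ← Set.ncard_coe_finset]
    congr 1
    ext x
    exact hmem x
  have hpos : (cycleLength f y : ℚ) ≠ 0 := by exact_mod_cast (cycleLength_pos f y).ne'
  rw [hcard]
  field_simp

end CycleLength

/-! ### Euler's formula as a sum over darts -/

section Euler

open Equiv Equiv.Perm

variable {V : Type*} {G : SimpleGraph V}

namespace RotationSystem

variable (ρ : RotationSystem G)

/-- The length of the face traced along a dart. -/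
noncomputable def faceLength (d : G.Dart) : ℕ := cycleLength ρ.facePerm d

theorem sameCycle_next_iff {d e : G.Dart} : ρ.next.SameCycle d e ↔ d.fst = e.fst :=
  ⟨fun h => sameCycle_eq_of_invariant (h := fun d : G.Dart => d.fst) ρ.next_fst h,
    ρ.sameCycle_of_fst_eq d e⟩

theorem cycleLength_next (d : G.Dart) : cycleLength ρ.next d = valency G d.fst := by
  refine Set.ncard_congr (fun e _ => e.snd) ?_ ?_ ?_
  · intro e he
    have : d.fst = e.fst := ρ.sameCycle_next_iff.1 he
    change G.Adj d.fst e.snd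
    rw [this]
    exact e.adj
  · intro e e' he he' h
    have h1 : d.fst = e.fst := ρ.sameCycle_next_iff.1 he
    have h2 : d.fst = e'.fst := ρ.sameCycle_next_iff.1 he'
    exact SimpleGraph.Dart.ext _ _ (Prod.ext (h1.symm.trans h2) h)
  · intro w hw
    exact ⟨⟨(d.fst, w), hw⟩, ρ.sameCycle_next_iff.2 rfl, rfl⟩

theorem card_le_numCycles_next_add [Finite V] :
    Nat.card V ≤ numCycles ρ.next + Nat.card {v : V // ∀ w, ¬ G.Adj v w} := by
  classical
  have := finite_dart G
  let F : V → Quotient (SameCycle.setoid ρ.next) ⊕ {v : V // ∀ w, ¬ G.Adj v w} := fun v =>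
    if h : ∀ w, ¬ G.Adj v w then Sum.inr ⟨v, h⟩
    else Sum.inl (Quotient.mk _
      ⟨(v, (not_forall_not.1 h).choose), (not_forall_not.1 h).choose_spec⟩)
  have hF : Function.Injective F := by
    intro v v' h
    simp only [F] at h
    split_ifs at h with h1 h2 h2
    · simpa using h
    · exact ρ.sameCycle_next_iff.1 (Quotient.exact (Sum.inl.inj h))
  have := Nat.card_le_card_of_injective F hF
  rwa [Nat.card_sum] at this

theorem card_isolated_lt [Finite V] (d : G.Dart) :
    Nat.card {v : V // ∀ w, ¬ G.Adj v w} + 1 ≤ Nat.card G.ConnectedComponent := by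
  let F : Option {v : V // ∀ w, ¬ G.Adj v w} → G.ConnectedComponent := fun o =>
    o.elim (G.connectedComponentMk d.fst) (fun v => G.connectedComponentMk v.1)
  have hiso : ∀ {v x : V}, (∀ w, ¬ G.Adj v w) → G.Reachable v x → v = x := by
    rintro v x hv ⟨p⟩
    cases p with
    | nil => rfl
    | cons h _ => exact absurd h (hv _)
  have hF : Function.Injective F := by
    rintro (_ | v) (_ | w) h
    · rfl
    · have := hiso w.2 (SimpleGraph.ConnectedComponent.exact h).symm
      exact absurd d.adj (this ▸ w.2 _)
    · have := hiso v.2 (SimpleGraph.ConnectedComponent.exact h)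
      exact absurd d.adj (this ▸ v.2 _)
    · have := hiso v.2 (SimpleGraph.ConnectedComponent.exact h)
      rw [Subtype.ext this]
  have := Nat.card_le_card_of_injective F hF
  rwa [Finite.card_option] at this

/-- The combinatorial Gauss–Bonnet inequality: the total curvature of a graph on the torus or the
sphere is nonnegative. -/
theorem sum_curvature_nonneg [Finite V] [Fintype G.Dart] [Nonempty G.Dart]
    (h : 2 * (Nat.card G.ConnectedComponent : ℤ) - 2 ≤ ρ.eulerChar) :
    0 ≤ ∑ d : G.Dart, ((1 : ℚ) / valency G d.fst + 1 / ρ.faceLength d - 1 / 2) := by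
  classical
  have := Fintype.ofFinite V
  obtain ⟨d⟩ := ‹Nonempty G.Dart›
  have h1 := ρ.card_le_numCycles_next_add
  have h2 := card_isolated_lt d
  have h3 : Fintype.card G.Dart = 2 * Nat.card G.edgeSet := by
    have := G.dart_card_eq_twice_card_edges
    rw [Nat.card_eq_fintype_card, ← SimpleGraph.edgeFinset_card, ← this]
    convert rfl
  have h4 : ∑ d : G.Dart, (1 : ℚ) / valency G d.fst = numCycles ρ.next := by
    rw [← sum_inv_cycleLength]
    exact Finset.sum_congr rfl fun d _ => by rw [cycleLength_next]
  have h5 : ∑ d : G.Dart, (1 : ℚ) / ρ.faceLength d = numCycles ρ.facePerm :=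
    sum_inv_cycleLength _
  rw [Finset.sum_sub_distrib, Finset.sum_add_distrib, h4, h5, Finset.sum_const, Finset.card_univ,
    h3, nsmul_eq_mul]
  unfold eulerChar numFaces at h
  -- An isolated vertex adds 2 to the Euler characteristic, once as a vertex and once as a face, and
  -- it also accounts for 2 in twice the number of components. The component of the dart `d` absorbs
  -- the remaining `- 2`.
  have h6 : (0 : ℤ) ≤ numCycles ρ.next + numCycles ρ.facePerm - Nat.card G.edgeSet := by
    unfold numCycles at *
    push_cast at h
    omega
  have h7 : (0 : ℚ) ≤ numCycles ρ.next + numCycles ρ.facePerm - Nat.card G.edgeSet := by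
    exact_mod_cast h6
  push_cast
  linarith

end RotationSystem

end Euler

/-! ### Short faces and their neighbours -/

section LocalStructure

variable {V : Type*} {G : SimpleGraph V}

/-- The properties of a graph without configurations to which no reduction applies. -/
structure IsObstruction (G : SimpleGraph V) : Prop where
  avoids : AvoidsConfigurations G
  three_le : ∀ {v w : V}, G.Adj v w → 3 ≤ valency G v
  not_hasReducible : ¬ HasReducible G

namespace RotationSystem

variable (ρ : RotationSystem G)

/-- Some face passes through `u`, `v`, `w` consecutively. -/
def Corner (u v w : V) : Prop :=
  ∃ (h : G.Adj v u) (h' : G.Adj v w), ρ.next ⟨(v, u), h⟩ = ⟨(v, w), h'⟩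

/-- `u v w` is a face. -/
def Face3 (u v w : V) : Prop := ρ.Corner u v w ∧ ρ.Corner v w u ∧ ρ.Corner w u v

/-- `u v w x` is a face. -/
def Face4 (u v w x : V) : Prop :=
  ρ.Corner u v w ∧ ρ.Corner v w x ∧ ρ.Corner w x u ∧ ρ.Corner x u v

/-- `u v w x y` is a face. -/
def Face5 (u v w x y : V) : Prop :=
  ρ.Corner u v w ∧ ρ.Corner v w x ∧ ρ.Corner w x y ∧ ρ.Corner x y u ∧ ρ.Corner y u v

/-- `u v w x y z` is a face. -/
def Face6 (u v w x y z : V) : Prop :=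
  ρ.Corner u v w ∧ ρ.Corner v w x ∧ ρ.Corner w x y ∧ ρ.Corner x y z ∧ ρ.Corner y z u ∧
    ρ.Corner z u v

variable {ρ}

theorem Corner.adj_left {u v w : V} (h : ρ.Corner u v w) : G.Adj u v := h.1.symm

theorem Corner.adj_right {u v w : V} (h : ρ.Corner u v w) : G.Adj v w := h.2.1

theorem Face5.rotate {a b c d e : V} (h : ρ.Face5 a b c d e) : ρ.Face5 b c d e a :=
  ⟨h.2.1, h.2.2.1, h.2.2.2.1, h.2.2.2.2, h.1⟩

variable [Finite V]

theorem Corner.ne (hG : IsObstruction G) {u v w : V} (h : ρ.Corner u v w) : u ≠ w := by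
  rintro rfl
  obtain ⟨h1, h2, h3⟩ := h
  have := finite_dart G
  have h4 := (pow_apply_eq_self_iff_cycleLength_dvd ρ.next ⟨(v, u), h1⟩ 1).1 (by simpa using h3)
  rw [cycleLength_next] at h4
  have h5 := hG.three_le h1
  have h6 : valency G v ≤ 1 := Nat.le_of_dvd one_pos h4
  omega

/-- The square of `next` would fix a dart at `v`, so the degree of `v` would divide 2. In the lemmas
below this keeps the vertices of two faces across an edge distinct. -/
theorem Corner.asymm (hG : IsObstruction G) {u v w : V} (h : ρ.Corner u v w)
    (h' : ρ.Corner w v u) : False := by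
  obtain ⟨h1, h2, h3⟩ := h
  obtain ⟨h1', h2', h3'⟩ := h'
  have := finite_dart G
  have h4 := (pow_apply_eq_self_iff_cycleLength_dvd ρ.next ⟨(v, u), h1⟩ 2).1 (by
    rw [pow_two, Equiv.Perm.mul_apply, h3, h3'])
  rw [cycleLength_next] at h4
  have h5 := hG.three_le h1
  have h6 : valency G v ≤ 2 := Nat.le_of_dvd two_pos h4
  omega

/-- The face on the other side traverses the common edge backwards, hence the order `v u`. Distinct
third vertices give graph (a). -/
theorem not_face3_face3 (hG : IsObstruction G) {u v w x : V} (h : ρ.Face3 u v w)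
    (h' : ρ.Face3 v u x) : False := by
  obtain ⟨a1, a2, a3⟩ := h
  obtain ⟨b1, b2, b3⟩ := h'
  by_cases hwx : w = x
  · subst hwx
    exact a1.asymm hG b3
  · exact chordedC4_free_elim hG.avoids.1 a3.adj_left.symm a2.adj_left.symm b3.adj_left.symm
      b2.adj_left.symm a1.adj_left hwx

theorem not_face3_face4 (hG : IsObstruction G) {u v w x y : V} (h : ρ.Face3 u v w)
    (h' : ρ.Face4 v u x y) : False := by
  obtain ⟨a1, a2, a3⟩ := h
  obtain ⟨b1, b2, b3, b4⟩ := h'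
  have hwx : w ≠ x := by rintro rfl; exact a3.asymm hG b1
  have hwy : w ≠ y := by rintro rfl; exact a1.asymm hG b4
  refine chordedC5_free_elim hG.avoids.2.1 (a := u) (b := w) (c := v) (d := y) (e := x) ?_
    a3.adj_left.symm a2.adj_left.symm b3.adj_right.symm b2.adj_right.symm b1.adj_right.symm
    a1.adj_left
  have := a1.ne hG; have := b1.ne hG; have := b2.ne hG
  have := a3.adj_left.ne; have := a1.adj_left.ne; have := a2.adj_left.ne; have := b1.adj_right.ne
  have := b3.adj_left.ne; have := b4.adj_left.ne
  simp only [List.nodup_cons, List.mem_cons, List.not_mem_nil, List.nodup_nil]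
  grind

/-- If `w = x` or `z = y`, one of the 4-cycles has a chord. Otherwise the faces form graph (c). -/
theorem not_face4_face4 (hG : IsObstruction G) {u v w z x y : V} (h : ρ.Face4 u v w z)
    (h' : ρ.Face4 v u x y) :
    False := by
  obtain ⟨a1, a2, a3, a4⟩ := h
  obtain ⟨b1, b2, b3, b4⟩ := h'
  have hwy : w ≠ y := by rintro rfl; exact a1.asymm hG b4
  have hzx : z ≠ x := by rintro rfl; exact a4.asymm hG b1
  have hwx : w ≠ x := by
    rintro rfl
    exact chordedC4_free_elim hG.avoids.1 a1.adj_left a2.adj_left a3.adj_left a4.adj_left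
      b1.adj_right (a2.ne hG)
  have hzy : z ≠ y := by
    rintro rfl
    exact chordedC4_free_elim hG.avoids.1 a2.adj_left a3.adj_left a4.adj_left a1.adj_left
      b4.adj_left.symm (a3.ne hG)
  refine chordedC6_free_elim hG.avoids.2.2.1 (a := u) (b := z) (c := w) (d := v) (e := y) (f := x)
    ?_ a4.adj_left.symm a3.adj_left.symm a2.adj_left.symm b4.adj_left.symm b3.adj_left.symm
    b2.adj_left.symm a1.adj_left
  have := a1.ne hG; have := a2.ne hG; have := b1.ne hG; have := b2.ne hG
  have := a1.adj_left.ne; have := a2.adj_left.ne; have := a3.adj_left.ne; have := a4.adj_left.ne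
  have := b2.adj_left.ne; have := b3.adj_left.ne; have := b4.adj_left.ne
  simp only [List.nodup_cons, List.mem_cons, List.not_mem_nil, List.nodup_nil]
  grind

/-- The boundary of the 6-face might repeat vertices. Each repetition, and each way for `w` to lie
on it, contradicts the minimum degree or yields a 4-cycle with a chord. What is left is graph (d).
-/
theorem not_face3_face6 (hG : IsObstruction G) {u v w a b c d : V} (h : ρ.Face3 u v w)
    (h' : ρ.Face6 v u a b c d) :
    False := by
  obtain ⟨a1, a2, a3⟩ := h
  obtain ⟨b1, b2, b3, b4, b5, b6⟩ := h'
  have huv := a1.adj_left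
  have hvw := a2.adj_left
  have hwu := a3.adj_left
  have hua := b2.adj_left
  have hab := b3.adj_left
  have hbc := b4.adj_left
  have hcd := b5.adj_left
  have hdv := b6.adj_left
  have hwa : w ≠ a := by rintro rfl; exact a3.asymm hG b1
  have hwd : w ≠ d := by rintro rfl; exact a1.asymm hG b6
  have hva := b1.ne hG
  have hub := b2.ne hG
  have hac := b3.ne hG
  have hbd := b4.ne hG
  have hcv := b5.ne hG
  have hdu := b6.ne hG
  have hbv : b ≠ v := by
    rintro rfl
    exact chordedC4_free_elim hG.avoids.1 hwu.symm hvw.symm hab.symm hua.symm huv hwa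
  have hcu : c ≠ u := by
    rintro rfl
    exact chordedC4_free_elim hG.avoids.1 hwu.symm hvw.symm hdv.symm hcd.symm huv hwd
  have had : a ≠ d := by
    rintro rfl
    exact chordedC4_free_elim hG.avoids.1 hwu.symm hvw.symm hdv.symm hua.symm huv hwa
  have hwb : w ≠ b := by
    rintro rfl
    exact chordedC4_free_elim hG.avoids.1 huv hvw hab.symm hua.symm hwu.symm hva
  have hwc : w ≠ c := by
    rintro rfl
    exact chordedC4_free_elim hG.avoids.1 huv.symm hwu.symm hcd hdv hvw hdu.symm
  refine triangleOnC6_free_elim hG.avoids.2.2.2.1 (a := v) (b := u) (c := a) (d := b) (e := c)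
    (f := d) (x := w) ?_ huv.symm hua hab hbc hcd hdv hvw hwu
  have := huv.ne; have := hvw.ne; have := hwu.ne; have := hua.ne; have := hab.ne; have := hbc.ne
  have := hcd.ne; have := hdv.ne
  simp only [List.nodup_cons, List.mem_cons, List.not_mem_nil, List.nodup_nil]
  grind

/-- In a closed walk of length 5 any two positions are at distance at most 2, so adjacency and
`Corner.ne` suffice. -/
theorem Face5.nodup (hG : IsObstruction G) {a b c d e : V} (h : ρ.Face5 a b c d e) :
    [a, b, c, d, e].Nodup := by
  obtain ⟨a1, a2, a3, a4, a5⟩ := h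
  have := a1.ne hG; have := a2.ne hG; have := a3.ne hG; have := a4.ne hG; have := a5.ne hG
  have := a1.adj_left.ne; have := a2.adj_left.ne; have := a3.adj_left.ne; have := a4.adj_left.ne
  have := a5.adj_left.ne
  simp only [List.nodup_cons, List.mem_cons, List.not_mem_nil, List.nodup_nil]
  grind

theorem Face5.not_adj (hG : IsObstruction G) {a b c d e : V}
    (h : ρ.Face5 a b c d e) : ¬ G.Adj a c := fun hac =>
  chordedC5_free_elim hG.avoids.2.1 (h.nodup hG) h.1.adj_left h.2.1.adj_left h.2.2.1.adj_left
    h.2.2.2.1.adj_left h.2.2.2.2.adj_left hac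

theorem Face5.notMem_of_face3 (hG : IsObstruction G) {a b c d e x : V} (h : ρ.Face5 a b c d e)
    (h' : ρ.Face3 b a x) :
    x ∉ [a, b, c, d, e] := by
  have h1 : x ≠ a := h'.1.adj_right.ne.symm
  have h2 : x ≠ b := h'.2.2.adj_left.ne
  have h3 : x ≠ c := by rintro rfl; exact h'.2.2.asymm hG h.1
  have h4 : x ≠ d := by rintro rfl; exact h.rotate.rotate.rotate.not_adj hG h'.1.adj_right.symm
  have h5 : x ≠ e := by rintro rfl; exact h'.1.asymm hG h.2.2.2.2
  simp [h1, h2, h3, h4, h5]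

theorem Face5.notMem_of_face4 (hG : IsObstruction G) {a b c d e x y : V} (h : ρ.Face5 a b c d e)
    (h' : ρ.Face4 b a x y) : x ∉ [a, b, c, d, e] ∧ y ∉ [a, b, c, d, e] := by
  have h1 : x ≠ a := h'.1.adj_right.ne.symm
  have h2 : x ≠ b := (h'.1.ne hG).symm
  have h3 : x ≠ c := by rintro rfl; exact h.not_adj hG h'.1.adj_right
  have h4 : x ≠ d := by rintro rfl; exact h.rotate.rotate.rotate.not_adj hG h'.1.adj_right.symm
  have h5 : x ≠ e := by rintro rfl; exact h'.1.asymm hG h.2.2.2.2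
  have k1 : y ≠ a := (h'.2.1.ne hG).symm
  have k2 : y ≠ b := h'.2.2.1.adj_right.ne
  have k3 : y ≠ c := by rintro rfl; exact h'.2.2.2.asymm hG h.1
  have k4 : y ≠ d := by rintro rfl; exact h.rotate.not_adj hG h'.2.2.2.adj_left.symm
  have k5 : y ≠ e := by
    rintro rfl; exact h.rotate.rotate.rotate.rotate.not_adj hG h'.2.2.2.adj_left
  simp [h1, h2, h3, h4, h5, k1, k2, k3, k4, k5]

/-- The apex of a triangle attached to a 5-face is adjacent to no other vertex of the face. -/
theorem Face5.not_adj_apex (hG : IsObstruction G) {a b c d e x : V} (h : ρ.Face5 a b c d e)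
    (h' : ρ.Face3 b a x) :
    ¬ G.Adj x c ∧ ¬ G.Adj x d ∧ ¬ G.Adj x e := by
  have hn := h.nodup hG
  have hx := h.notMem_of_face3 hG h'
  have hab := h.1.adj_left
  have hbc := h.2.1.adj_left
  have hcd := h.2.2.1.adj_left
  have hea := h.2.2.2.2.adj_left
  have hax := h'.1.adj_right
  have hxb := h'.2.2.adj_left
  simp only [List.nodup_cons, List.mem_cons, List.not_mem_nil, List.nodup_nil] at hn hx
  refine ⟨fun k => ?_, fun k => ?_, fun k => ?_⟩
  · exact chordedC4_free_elim hG.avoids.1 hab.symm hax k hbc.symm hxb.symm (by grind)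
  · refine chordedC5_free_elim hG.avoids.2.1 (a := b) (b := a) (c := x) (d := d) (e := c) ?_
      hab.symm hax k hcd.symm hbc.symm hxb.symm
    simp only [List.nodup_cons, List.mem_cons, List.not_mem_nil, List.nodup_nil]
    grind
  · exact chordedC4_free_elim hG.avoids.1 hab hxb.symm k hea hax (by grind)

/-- Rerouting the 5-cycle through `x` instead of along `a b` makes it a 6-cycle that carries the
other triangle, which is graph (d). -/
theorem Face5.not_two_face3_adj (hG : IsObstruction G) {a b c d e x y : V} (h : ρ.Face5 a b c d e)
    (hx : ρ.Face3 b a x) (hy : ρ.Face3 c b y) : False := by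
  have hn := h.nodup hG
  have hxn := h.notMem_of_face3 hG hx
  have hyn := h.rotate.notMem_of_face3 hG hy
  have hxy : x ≠ y := by
    rintro rfl
    exact (h.not_adj_apex hG hx).1 hy.2.2.adj_left
  refine triangleOnC6_free_elim hG.avoids.2.2.2.1 (a := b) (b := c) (c := d) (d := e) (e := a)
    (f := x) (x := y) ?_ h.2.1.adj_left h.2.2.1.adj_left h.2.2.2.1.adj_left h.2.2.2.2.adj_left
    hx.1.adj_right hx.2.2.adj_left hy.1.adj_right hy.2.2.adj_left
  simp only [List.nodup_cons, List.mem_cons, List.not_mem_nil, List.nodup_nil] at *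
  grind

theorem Face5.not_two_face3_disj (hG : IsObstruction G) {a b c d e x y : V} (h : ρ.Face5 a b c d e)
    (hx : ρ.Face3 b a x) (hy : ρ.Face3 d c y) : False := by
  have hn := h.nodup hG
  have hxn := h.notMem_of_face3 hG hx
  have hyn := h.rotate.rotate.notMem_of_face3 hG hy
  have hxy : x ≠ y := by
    rintro rfl
    exact (h.not_adj_apex hG hx).2.1 hy.2.2.adj_left
  refine triangleOnC6_free_elim hG.avoids.2.2.2.1 (a := c) (b := d) (c := e) (d := a) (e := x)
    (f := b) (x := y) ?_ h.2.2.1.adj_left h.2.2.2.1.adj_left h.2.2.2.2.adj_left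
    hx.1.adj_right hx.2.2.adj_left h.2.1.adj_left hy.1.adj_right hy.2.2.adj_left
  simp only [List.nodup_cons, List.mem_cons, List.not_mem_nil, List.nodup_nil] at *
  grind

/-- The edges carrying the triangle and the 4-face share a vertex, which gives graph (e). The case
`x = y` is a 5-cycle with a chord, and `x = z` would join the apex to `c`. -/
theorem Face5.not_face3_face4_bc (hG : IsObstruction G) {a b c d e x y z : V}
    (h : ρ.Face5 a b c d e)
    (hx : ρ.Face3 b a x) (hy : ρ.Face4 c b y z) : False := by
  have hn := h.nodup hG
  have hxn := h.notMem_of_face3 hG hx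
  have hyn := h.rotate.notMem_of_face4 hG hy
  have hxe := h.not_adj_apex hG hx
  have hyz := hy.2.1.adj_right
  have hxy : x ≠ y := by
    rintro rfl
    refine chordedC5_free_elim hG.avoids.2.1 (a := b) (b := a) (c := x) (d := z) (e := c) ?_
      h.1.adj_left.symm hx.1.adj_right hyz hy.2.2.1.adj_right h.2.1.adj_left.symm
      hx.2.2.adj_left.symm
    have := hyz.ne
    simp only [List.nodup_cons, List.mem_cons, List.not_mem_nil, List.nodup_nil] at *
    grind
  have hxz : x ≠ z := by rintro rfl; exact hxe.1 hy.2.2.1.adj_right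
  refine triangleSquareOnC5Adj_free_elim hG.avoids.2.2.2.2.1 (a := c) (b := b) (c := a) (d := e)
    (e := d) (x := x) (y := y) (z := z) ?_ h.2.1.adj_left.symm h.1.adj_left.symm
    h.2.2.2.2.adj_left.symm h.2.2.2.1.adj_left.symm h.2.2.1.adj_left.symm hx.2.2.adj_left.symm
    hx.1.adj_right.symm hy.1.adj_right hyz hy.2.2.1.adj_right
  have := hyz.ne
  simp only [List.nodup_cons, List.mem_cons, List.not_mem_nil, List.nodup_nil] at *
  grind

theorem Face5.not_face3_face4_ea (hG : IsObstruction G) {a b c d e x y z : V}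
    (h : ρ.Face5 a b c d e)
    (hx : ρ.Face3 b a x) (hy : ρ.Face4 a e y z) : False := by
  have hn := h.nodup hG
  have hxn := h.notMem_of_face3 hG hx
  have hyn := h.rotate.rotate.rotate.rotate.notMem_of_face4 hG hy
  have hxe := h.not_adj_apex hG hx
  have hyz := hy.2.1.adj_right
  have hxz : x ≠ z := by
    rintro rfl
    refine chordedC5_free_elim hG.avoids.2.1 (a := a) (b := b) (c := x) (d := y) (e := e) ?_
      h.1.adj_left hx.2.2.adj_left.symm hyz.symm hy.1.adj_right.symm h.2.2.2.2.adj_left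
      hx.1.adj_right
    have := hyz.ne
    simp only [List.nodup_cons, List.mem_cons, List.not_mem_nil, List.nodup_nil] at *
    grind
  have hxy : x ≠ y := by rintro rfl; exact hxe.2.2 hy.1.adj_right.symm
  refine triangleSquareOnC5Adj_free_elim hG.avoids.2.2.2.2.1 (a := e) (b := a) (c := b) (d := c)
    (e := d) (x := x) (y := z) (z := y) ?_ h.2.2.2.2.adj_left h.1.adj_left h.2.1.adj_left
    h.2.2.1.adj_left h.2.2.2.1.adj_left hx.1.adj_right hx.2.2.adj_left hy.2.2.1.adj_right.symm
    hyz.symm hy.1.adj_right.symm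
  have := hyz.ne
  simp only [List.nodup_cons, List.mem_cons, List.not_mem_nil, List.nodup_nil] at *
  grind

/-- Here the two edges share no vertex, which gives graph (f). -/
theorem Face5.not_face3_face4_cd (hG : IsObstruction G) {a b c d e x y z : V}
    (h : ρ.Face5 a b c d e)
    (hx : ρ.Face3 b a x) (hy : ρ.Face4 d c y z) : False := by
  have hn := h.nodup hG
  have hxn := h.notMem_of_face3 hG hx
  have hyn := h.rotate.rotate.notMem_of_face4 hG hy
  have hxe := h.not_adj_apex hG hx
  have hyz := hy.2.1.adj_right
  have hxy : x ≠ y := by rintro rfl; exact hxe.1 hy.1.adj_right.symm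
  have hxz : x ≠ z := by rintro rfl; exact hxe.2.1 hy.2.2.1.adj_right
  refine triangleSquareOnC5Disj_free_elim hG.avoids.2.2.2.2.2 (a := d) (b := c) (c := b) (d := a)
    (e := e) (x := x) (y := y) (z := z) ?_ h.2.2.1.adj_left.symm h.2.1.adj_left.symm
    h.1.adj_left.symm h.2.2.2.2.adj_left.symm h.2.2.2.1.adj_left.symm hx.2.2.adj_left.symm
    hx.1.adj_right.symm hy.1.adj_right hyz hy.2.2.1.adj_right
  have := hyz.ne
  simp only [List.nodup_cons, List.mem_cons, List.not_mem_nil, List.nodup_nil] at *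
  grind

theorem Face5.not_face3_face4_de (hG : IsObstruction G) {a b c d e x y z : V}
    (h : ρ.Face5 a b c d e)
    (hx : ρ.Face3 b a x) (hy : ρ.Face4 e d y z) : False := by
  have hn := h.nodup hG
  have hxn := h.notMem_of_face3 hG hx
  have hyn := h.rotate.rotate.rotate.notMem_of_face4 hG hy
  have hxe := h.not_adj_apex hG hx
  have hyz := hy.2.1.adj_right
  have hxy : x ≠ y := by rintro rfl; exact hxe.2.1 hy.1.adj_right.symm
  have hxz : x ≠ z := by rintro rfl; exact hxe.2.2 hy.2.2.1.adj_right
  refine triangleSquareOnC5Disj_free_elim hG.avoids.2.2.2.2.2 (a := d) (b := e) (c := a) (d := b)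
    (e := c) (x := x) (y := z) (z := y) ?_ h.2.2.2.1.adj_left h.2.2.2.2.adj_left h.1.adj_left
    h.2.1.adj_left h.2.2.1.adj_left hx.1.adj_right hx.2.2.adj_left hy.2.2.1.adj_right.symm
    hyz.symm hy.1.adj_right.symm
  have := hyz.ne
  simp only [List.nodup_cons, List.mem_cons, List.not_mem_nil, List.nodup_nil] at *
  grind

/-- A 5-face with a triangle attached, all of whose vertices have degree at most 4, has at most one
vertex of degree 3. -/
theorem Face5.not_two_valency_three (hG : IsObstruction G) {a b c d e x : V} (h : ρ.Face5 a b c d e)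
    (hx : ρ.Face3 b a x) (va : valency G a ≤ 4) (vb : valency G b ≤ 4) (vc : valency G c ≤ 4)
    (vd : valency G d ≤ 4) (ve : valency G e ≤ 4) (vx : valency G x ≤ 4) :
    ¬ (valency G a = 3 ∧ valency G c = 3) ∧ ¬ (valency G a = 3 ∧ valency G d = 3) ∧
    ¬ (valency G b = 3 ∧ valency G d = 3) ∧ ¬ (valency G b = 3 ∧ valency G e = 3) ∧
    ¬ (valency G c = 3 ∧ valency G e = 3) := by
  have hn := h.nodup hG
  have hxn := h.notMem_of_face3 hG hx
  have hab := h.1.adj_left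
  have hbc := h.2.1.adj_left
  have hcd := h.2.2.1.adj_left
  have hde := h.2.2.2.1.adj_left
  have hea := h.2.2.2.2.adj_left
  have hax := hx.1.adj_right
  have hxb := hx.2.2.adj_left
  simp only [List.nodup_cons, List.mem_cons, List.not_mem_nil, List.nodup_nil] at hn hxn
  refine ⟨fun k => ?_, fun k => ?_, fun k => ?_, fun k => ?_, fun k => ?_⟩
  · refine hG.not_hasReducible (hasReducible_of_triangleOnC5_ac ?_ hab hbc hax hxb k.1.le vb
      k.2.le vx)
    simp only [List.nodup_cons, List.mem_cons, List.not_mem_nil, List.nodup_nil]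
    grind
  · refine hG.not_hasReducible (hasReducible_of_triangleOnC5_ad ?_ hab hbc hcd hde hea hax hxb
      k.1.le vb vc k.2.le ve vx)
    simp only [List.nodup_cons, List.mem_cons, List.not_mem_nil, List.nodup_nil]
    grind
  · refine hG.not_hasReducible (hasReducible_of_triangleOnC5_ad ?_ hab.symm hea.symm hde.symm
      hcd.symm hbc.symm hxb.symm hax.symm k.1.le va ve k.2.le vc vx)
    simp only [List.nodup_cons, List.mem_cons, List.not_mem_nil, List.nodup_nil]
    grind
  · refine hG.not_hasReducible (hasReducible_of_triangleOnC5_ac ?_ hab.symm hea.symm hxb.symm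
      hax.symm k.1.le va k.2.le vx)
    simp only [List.nodup_cons, List.mem_cons, List.not_mem_nil, List.nodup_nil]
    grind
  · refine hG.not_hasReducible (hasReducible_of_triangleOnC5_ce ?_ hab hbc hcd hde hea hax hxb
      va vb k.1.le vd k.2.le vx)
    simp only [List.nodup_cons, List.mem_cons, List.not_mem_nil, List.nodup_nil]
    grind

/-- A vertex of degree 3 on one 4-face and two 5-faces which have further vertices of degree 3. -/
theorem not_hub (hG : IsObstruction G) {h a r c d s y z p : V} (hq : ρ.Face4 h p a r)
    (hf : ρ.Face5 h r c d s)
    (hf' : ρ.Face5 h s y z p) (h4 : ∀ v, valency G v ≤ 4) (vh : valency G h = 3)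
    (hcd : valency G c = 3 ∨ valency G d = 3) (hyz : valency G y = 3 ∨ valency G z = 3) :
    False := by
  have hpr : p ≠ r := (hq.2.2.2.ne hG).symm
  have n1 := hf.nodup hG
  have n2 := hf'.nodup hG
  have q1 := hq.1.adj_left
  have q2 := hq.2.1.adj_left
  have q3 := hq.2.2.1.adj_left
  have q4 := hq.2.2.2.adj_left
  have f1 := hf.1.adj_left
  have f2 := hf.2.1.adj_left
  have f3 := hf.2.2.1.adj_left
  have f4 := hf.2.2.2.1.adj_left
  have f5 := hf.2.2.2.2.adj_left
  have g2 := hf'.2.1.adj_left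
  have g3 := hf'.2.2.1.adj_left
  have g4 := hf'.2.2.2.1.adj_left
  have hah : a ≠ h := (hq.1.ne hG).symm
  have hac : a ≠ c := by rintro rfl; exact hq.2.2.1.asymm hG hf.1
  have had : a ≠ d := by rintro rfl; exact hf.rotate.not_adj hG q3.symm
  have has : a ≠ s := by rintro rfl; exact hf.rotate.rotate.rotate.rotate.not_adj hG q3
  have hay : a ≠ y := by rintro rfl; exact hf'.rotate.rotate.not_adj hG q2.symm
  have haz : a ≠ z := by rintro rfl; exact hq.1.asymm hG hf'.2.2.2.1
  have hry : r ≠ y := by rintro rfl; exact hf'.not_adj hG f1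
  have hrz : r ≠ z := by rintro rfl; exact hf'.rotate.rotate.rotate.not_adj hG f1.symm
  have hcp : c ≠ p := by rintro rfl; exact hf.not_adj hG q1
  have hdp : d ≠ p := by rintro rfl; exact hf.rotate.rotate.rotate.not_adj hG q1.symm
  have hcy : c ≠ y := by rintro rfl; exact hf.rotate.rotate.not_adj hG g2.symm
  have hdy : d ≠ y := by rintro rfl; exact hf.2.2.2.1.asymm hG hf'.1
  have hdz : d ≠ z := by rintro rfl; exact hf'.rotate.not_adj hG f4.symm
  simp only [List.nodup_cons, List.mem_cons, List.not_mem_nil, List.nodup_nil] at n1 n2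
  -- This is the only coincidence not yet excluded. Then `c` has the neighbours `y`, `p`, `d`, `r`,
  -- so the further vertices of degree 3 are `d` and `y`, opposite on the 4-cycle `d s y c`.
  by_cases hcz : c = z
  · subst hcz
    have hc : 4 ≤ valency G c := by
      have hsub : ({y, p, d, r} : Set V) ⊆ G.neighborSet c := by
        rintro v (rfl | rfl | rfl | rfl)
        · exact g3.symm
        · exact g4
        · exact f3
        · exact f2.symm
      have := Set.ncard_le_ncard hsub (Set.toFinite _)
      rwa [Set.ncard_insert_of_notMem (by simp; grind), Set.ncard_insert_of_notMem (by simp; grind),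
        Set.ncard_pair (by grind)] at this
    refine hG.not_hasReducible (hasReducible_of_C4 (a := d) (b := s) (c := y) (d := c) ?_ f4 g2 g3
      f3 (by omega) (h4 _) (by omega) (h4 _))
    simp only [List.nodup_cons, List.mem_cons, List.not_mem_nil, List.nodup_nil]
    grind
  · refine hG.not_hasReducible (hasReducible_of_hub (h := h) (a := a) (b := r) (c := c) (d := d)
      (e := s) (f := y) (k := z) (g := p) ?_ q3 f2 f3 f4 g2 g3 g4 q2 f1 f5.symm q1 vh.le (h4 _)
      (h4 _) (h4 _) (h4 _) (h4 _) (h4 _) (h4 _) (h4 _) (hcd.imp Eq.le Eq.le)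
      (hyz.imp Eq.le Eq.le))
    have := q2.ne; have := q3.ne
    simp only [List.nodup_cons, List.mem_cons, List.not_mem_nil, List.nodup_nil]
    grind

end RotationSystem

end LocalStructure

/-! ### From face lengths of darts to faces as vertex sequences -/

section DartStructure

open Equiv Equiv.Perm

variable {V : Type*} {G : SimpleGraph V}

namespace RotationSystem

variable (ρ : RotationSystem G)

theorem faceLength_facePerm (d : G.Dart) : ρ.faceLength (ρ.facePerm d) = ρ.faceLength d :=
  cycleLength_apply _ _

theorem facePerm_symm_apply (d : G.Dart) : ρ.facePerm d.symm = ρ.next d := by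
  rw [facePerm_apply, SimpleGraph.Dart.symm_symm]

theorem faceLength_next (d : G.Dart) : ρ.faceLength (ρ.next d) = ρ.faceLength d.symm := by
  rw [← facePerm_symm_apply, faceLength_facePerm]

theorem faceLength_facePerm_symm (d : G.Dart) :
    ρ.faceLength (ρ.facePerm.symm d) = ρ.faceLength d := by
  rw [← faceLength_facePerm, Equiv.apply_symm_apply]

theorem symm_facePerm_symm (d : G.Dart) : (ρ.facePerm.symm d).symm = ρ.next.symm d := by
  rw [Equiv.eq_symm_apply, ← facePerm_apply, Equiv.apply_symm_apply]

theorem facePerm_symm_fst (d : G.Dart) : (ρ.facePerm d.symm).fst = d.fst := by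
  rw [facePerm_symm_apply, next_fst]

theorem corner_facePerm (d : G.Dart) :
    ρ.Corner d.fst (ρ.facePerm d).fst (ρ.facePerm (ρ.facePerm d)).fst := by
  rw [ρ.facePerm_fst d, ρ.facePerm_fst (ρ.facePerm d)]
  refine ⟨d.adj.symm, ?_, ?_⟩
  · have := (ρ.facePerm d).adj
    rwa [show (ρ.facePerm d).toProd.1 = d.snd from ρ.facePerm_fst d] at this
  · change ρ.facePerm d = _
    exact SimpleGraph.Dart.ext _ _ (Prod.ext (ρ.facePerm_fst d) rfl)

theorem not_valency_three_facePerm (ρ : RotationSystem G) (hG : IsObstruction G) (d : G.Dart) :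
    ¬ (valency G d.fst = 3 ∧ valency G (ρ.facePerm d).fst = 3) := by
  rw [facePerm_fst]
  exact fun k => hG.not_hasReducible (hasReducible_of_adj d.adj k.1.le k.2.le)

/-- The five darts of a 5-face, in order. -/
structure FiveFace (d₀ d₁ d₂ d₃ d₄ : G.Dart) : Prop where
  h₀ : ρ.facePerm d₀ = d₁
  h₁ : ρ.facePerm d₁ = d₂
  h₂ : ρ.facePerm d₂ = d₃
  h₃ : ρ.facePerm d₃ = d₄
  h₄ : ρ.facePerm d₄ = d₀
  length : ρ.faceLength d₀ = 5

variable {ρ} in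
theorem FiveFace.rotate {d₀ d₁ d₂ d₃ d₄ : G.Dart} (h : ρ.FiveFace d₀ d₁ d₂ d₃ d₄) :
    ρ.FiveFace d₁ d₂ d₃ d₄ d₀ :=
  ⟨h.h₁, h.h₂, h.h₃, h.h₄, h.h₀, by rw [← h.h₀, faceLength_facePerm, h.length]⟩

variable {ρ} in
theorem FiveFace.face5 {d₀ d₁ d₂ d₃ d₄ : G.Dart} (h : ρ.FiveFace d₀ d₁ d₂ d₃ d₄) :
    ρ.Face5 d₀.fst d₁.fst d₂.fst d₃.fst d₄.fst := by
  have k0 := ρ.corner_facePerm d₀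
  have k1 := ρ.corner_facePerm d₁
  have k2 := ρ.corner_facePerm d₂
  have k3 := ρ.corner_facePerm d₃
  have k4 := ρ.corner_facePerm d₄
  simp only [h.h₀, h.h₁, h.h₂, h.h₃, h.h₄] at k0 k1 k2 k3 k4
  exact ⟨k0, k1, k2, k3, k4⟩

variable [Finite V]

theorem facePerm_pow_faceLength {d : G.Dart} {n : ℕ} (h : ρ.faceLength d = n) :
    (ρ.facePerm ^ n) d = d := by
  have := finite_dart G
  exact (pow_apply_eq_self_iff_cycleLength_dvd _ _ _).2 (dvd_of_eq h)

theorem face3_of_faceLength {d : G.Dart} (h : ρ.faceLength d = 3) :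
    ρ.Face3 d.fst (ρ.facePerm d).fst (ρ.facePerm (ρ.facePerm d)).fst := by
  have hp : ρ.facePerm (ρ.facePerm (ρ.facePerm d)) = d := ρ.facePerm_pow_faceLength h
  have h0 := ρ.corner_facePerm d
  have h1 := ρ.corner_facePerm (ρ.facePerm d)
  have h2 := ρ.corner_facePerm (ρ.facePerm (ρ.facePerm d))
  rw [hp] at h1 h2
  exact ⟨h0, h1, h2⟩

theorem face4_of_faceLength {d : G.Dart} (h : ρ.faceLength d = 4) :
    ρ.Face4 d.fst (ρ.facePerm d).fst (ρ.facePerm (ρ.facePerm d)).fst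
      (ρ.facePerm (ρ.facePerm (ρ.facePerm d))).fst := by
  have hp : ρ.facePerm (ρ.facePerm (ρ.facePerm (ρ.facePerm d))) = d :=
    ρ.facePerm_pow_faceLength h
  have h0 := ρ.corner_facePerm d
  have h1 := ρ.corner_facePerm (ρ.facePerm d)
  have h2 := ρ.corner_facePerm (ρ.facePerm (ρ.facePerm d))
  have h3 := ρ.corner_facePerm (ρ.facePerm (ρ.facePerm (ρ.facePerm d)))
  rw [hp] at h2 h3
  exact ⟨h0, h1, h2, h3⟩

theorem face6_of_faceLength {d : G.Dart} (h : ρ.faceLength d = 6) :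
    ρ.Face6 d.fst (ρ.facePerm d).fst (ρ.facePerm (ρ.facePerm d)).fst
      (ρ.facePerm (ρ.facePerm (ρ.facePerm d))).fst
      (ρ.facePerm (ρ.facePerm (ρ.facePerm (ρ.facePerm d)))).fst
      (ρ.facePerm (ρ.facePerm (ρ.facePerm (ρ.facePerm (ρ.facePerm d))))).fst := by
  have hp : ρ.facePerm (ρ.facePerm (ρ.facePerm (ρ.facePerm (ρ.facePerm (ρ.facePerm d))))) = d :=
    ρ.facePerm_pow_faceLength h
  have h0 := ρ.corner_facePerm d
  have h1 := ρ.corner_facePerm (ρ.facePerm d)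
  have h2 := ρ.corner_facePerm (ρ.facePerm (ρ.facePerm d))
  have h3 := ρ.corner_facePerm (ρ.facePerm (ρ.facePerm (ρ.facePerm d)))
  have h4 := ρ.corner_facePerm (ρ.facePerm (ρ.facePerm (ρ.facePerm (ρ.facePerm d))))
  have h5 := ρ.corner_facePerm (ρ.facePerm (ρ.facePerm (ρ.facePerm (ρ.facePerm (ρ.facePerm d)))))
  rw [hp] at h4 h5
  exact ⟨h0, h1, h2, h3, h4, h5⟩

variable {ρ}

theorem fiveFace_of_faceLength {d : G.Dart} (h : ρ.faceLength d = 5) :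
    ρ.FiveFace d (ρ.facePerm d) (ρ.facePerm (ρ.facePerm d))
      (ρ.facePerm (ρ.facePerm (ρ.facePerm d)))
      (ρ.facePerm (ρ.facePerm (ρ.facePerm (ρ.facePerm d)))) :=
  ⟨rfl, rfl, rfl, rfl, ρ.facePerm_pow_faceLength h, h⟩

/-- The triangle across the edge of a dart. -/
theorem face3_across {d : G.Dart} (h : ρ.faceLength d.symm = 3) :
    ρ.Face3 (ρ.facePerm d).fst d.fst (ρ.facePerm.symm d.symm).fst := by
  have h3 := ρ.face3_of_faceLength h
  have hp : ρ.facePerm (ρ.facePerm (ρ.facePerm d.symm)) = d.symm := ρ.facePerm_pow_faceLength h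
  have hi : ρ.facePerm.symm d.symm = ρ.facePerm (ρ.facePerm d.symm) := by
    rw [Equiv.symm_apply_eq, hp]
  rw [facePerm_symm_fst] at h3
  rw [hi, facePerm_fst]
  exact h3

/-- The 4-face across the edge of a dart. -/
theorem face4_across {d : G.Dart} (h : ρ.faceLength d.symm = 4) :
    ∃ x y, ρ.Face4 (ρ.facePerm d).fst d.fst x y := by
  have h4 := ρ.face4_of_faceLength h
  rw [facePerm_symm_fst] at h4
  rw [facePerm_fst]
  exact ⟨_, _, h4⟩

theorem three_le_faceLength (hG : IsObstruction G) (d : G.Dart) : 3 ≤ ρ.faceLength d := by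
  have := finite_dart G
  have hpos : 0 < ρ.faceLength d := cycleLength_pos _ _
  by_contra hlt
  have hp := ρ.facePerm_pow_faceLength (d := d) rfl
  rcases (by omega : ρ.faceLength d = 1 ∨ ρ.faceLength d = 2) with h | h
  · rw [h, pow_one] at hp
    have := ρ.facePerm_fst d
    rw [hp] at this
    exact d.adj.ne this
  · rw [h] at hp
    have hp' : ρ.facePerm (ρ.facePerm d) = d := hp
    have := ρ.corner_facePerm d
    rw [hp'] at this
    exact this.ne hG rfl

theorem five_le_faceLength_symm (hG : IsObstruction G) {d : G.Dart} (h : ρ.faceLength d ≤ 4) :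
    5 ≤ ρ.faceLength d.symm := by
  by_contra hlt
  have h1 := three_le_faceLength (ρ := ρ) hG d
  have h2 := three_le_faceLength (ρ := ρ) hG d.symm
  rcases (by omega : ρ.faceLength d = 3 ∨ ρ.faceLength d = 4) with h3 | h3 <;>
    rcases (by omega : ρ.faceLength d.symm = 3 ∨ ρ.faceLength d.symm = 4) with h4 | h4
  · exact not_face3_face3 hG (ρ.face3_of_faceLength h3) (face3_across h4)
  · obtain ⟨x, y, h5⟩ := face4_across h4
    exact not_face3_face4 hG (ρ.face3_of_faceLength h3) h5
  · obtain ⟨x, y, h5⟩ := face4_across (d := d.symm) (by rwa [SimpleGraph.Dart.symm_symm])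
    rw [facePerm_symm_fst] at h5
    have h6 := face3_across h4
    rw [facePerm_fst] at h6
    exact not_face3_face4 hG h6 h5
  · obtain ⟨x, y, h5⟩ := face4_across h4
    exact not_face4_face4 hG (ρ.face4_of_faceLength h3) h5

theorem faceLength_symm_ne_three (hG : IsObstruction G) {d : G.Dart} (h : ρ.faceLength d = 6) :
    ρ.faceLength d.symm ≠ 3 := by
  intro h3
  have h5 := face3_across h3
  exact not_face3_face6 hG h5 (ρ.face6_of_faceLength h)

/-- A 5-face with a triangle across one of its edges has only large faces across the others. -/
theorem FiveFace.five_le_symm (hG : IsObstruction G) {d₀ d₁ d₂ d₃ d₄ : G.Dart}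
    (h : ρ.FiveFace d₀ d₁ d₂ d₃ d₄) (h3 : ρ.faceLength d₀.symm = 3) :
    5 ≤ ρ.faceLength d₁.symm ∧ 5 ≤ ρ.faceLength d₂.symm ∧ 5 ≤ ρ.faceLength d₃.symm ∧
      5 ≤ ρ.faceLength d₄.symm := by
  have hf := h.face5
  have k := face3_across h3
  rw [h.h₀] at k
  have l1 := three_le_faceLength (ρ := ρ) hG d₁.symm
  have l2 := three_le_faceLength (ρ := ρ) hG d₂.symm
  have l3 := three_le_faceLength (ρ := ρ) hG d₃.symm
  have l4 := three_le_faceLength (ρ := ρ) hG d₄.symm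
  refine ⟨?_, ?_, ?_, ?_⟩ <;> by_contra hlt
  · rcases (by omega : ρ.faceLength d₁.symm = 3 ∨ ρ.faceLength d₁.symm = 4) with e | e
    · have := face3_across e
      rw [h.h₁] at this
      exact hf.not_two_face3_adj hG k this
    · obtain ⟨x, y, this⟩ := face4_across e
      rw [h.h₁] at this
      exact hf.not_face3_face4_bc hG k this
  · rcases (by omega : ρ.faceLength d₂.symm = 3 ∨ ρ.faceLength d₂.symm = 4) with e | e
    · have := face3_across e
      rw [h.h₂] at this
      exact hf.not_two_face3_disj hG k this
    · obtain ⟨x, y, this⟩ := face4_across e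
      rw [h.h₂] at this
      exact hf.not_face3_face4_cd hG k this
  · rcases (by omega : ρ.faceLength d₃.symm = 3 ∨ ρ.faceLength d₃.symm = 4) with e | e
    · have := face3_across e
      rw [h.h₃] at this
      exact hf.rotate.rotate.rotate.not_two_face3_disj hG this k
    · obtain ⟨x, y, this⟩ := face4_across e
      rw [h.h₃] at this
      exact hf.not_face3_face4_de hG k this
  · rcases (by omega : ρ.faceLength d₄.symm = 3 ∨ ρ.faceLength d₄.symm = 4) with e | e
    · have := face3_across e
      rw [h.h₄] at this
      exact hf.rotate.rotate.rotate.rotate.not_two_face3_adj hG this k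
    · obtain ⟨x, y, this⟩ := face4_across e
      rw [h.h₄] at this
      exact hf.not_face3_face4_ea hG k this

theorem next_cube {d : G.Dart} (h : valency G d.fst = 3) : ρ.next (ρ.next (ρ.next d)) = d := by
  have := finite_dart G
  exact (pow_apply_eq_self_iff_cycleLength_dvd ρ.next d 3).2
    (dvd_of_eq (by rw [cycleLength_next, h]))

end RotationSystem

end DartStructure

/-! ### Discharging rules and final charges -/

section Discharging

open Equiv Equiv.Perm

variable {V : Type*} {G : SimpleGraph V}

namespace RotationSystem

variable (ρ : RotationSystem G)

open Classical in
/-- What the face of a dart pays to the initial vertex of the dart, if this has degree 3. -/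
noncomputable def pay (d : G.Dart) : ℚ :=
  if valency G d.fst = 3 ∧ 5 ≤ ρ.faceLength d then
    if ρ.faceLength d.symm ≤ 4 ∨ ρ.faceLength (ρ.facePerm.symm d).symm ≤ 4 then 3 else 2
  else 0

/-- The indicator of a triangle. -/
noncomputable def tri (d : G.Dart) : ℚ := if ρ.faceLength d = 3 then 1 else 0

/-- The indicator of an initial vertex of degree at least 5. -/
noncomputable def big (d : G.Dart) : ℚ := if 5 ≤ valency G d.fst then 1 else 0

/-- The final charge of a dart at its initial vertex. -/
noncomputable def vertexCharge (d : G.Dart) : ℚ :=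
  6 - 24 / valency G d.fst + ρ.pay d - big d

/-- The final charge of a dart at its face. -/
noncomputable def faceCharge (d : G.Dart) : ℚ :=
  -- A face gives 2 to each triangle across its edges. A vertex of degree at least 5 gives 1 to each
  -- face at it. A triangle passes this unit on across the edge opposite to the vertex;
  -- `ρ.facePerm.symm d.symm` starts at the apex of the triangle across `d`.
  6 - 24 / ρ.faceLength d - ρ.pay d - 2 * ρ.tri d.symm + 2 * ρ.tri d + big d * (1 - ρ.tri d) +
    big (ρ.facePerm.symm d.symm) * ρ.tri d.symm

theorem tri_nonneg (d : G.Dart) : 0 ≤ ρ.tri d := by unfold tri; split_ifs <;> simp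

theorem tri_le_one (d : G.Dart) : ρ.tri d ≤ 1 := by unfold tri; split_ifs <;> simp

theorem big_nonneg (d : G.Dart) : 0 ≤ big d := by unfold big; split_ifs <;> simp

theorem pay_nonneg (d : G.Dart) : 0 ≤ ρ.pay d := by unfold pay; split_ifs <;> simp

theorem pay_le (d : G.Dart) : ρ.pay d ≤ 3 := by unfold pay; split_ifs <;> norm_num

theorem pay_eq_zero {d : G.Dart} (h : valency G d.fst ≠ 3) : ρ.pay d = 0 := by
  unfold pay; rw [if_neg (fun k => h k.1)]

theorem pay_eq_zero_of_faceLength {d : G.Dart} (h : ρ.faceLength d ≤ 4) : ρ.pay d = 0 := by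
  unfold pay; rw [if_neg (fun k => by omega)]

theorem tri_eq_zero {d : G.Dart} (h : ρ.faceLength d ≠ 3) : ρ.tri d = 0 := if_neg h

theorem tri_eq_one {d : G.Dart} (h : ρ.faceLength d = 3) : ρ.tri d = 1 := if_pos h

theorem tri_facePerm_symm (d : G.Dart) : ρ.tri (ρ.facePerm.symm d) = ρ.tri d := by
  unfold tri; rw [faceLength_facePerm_symm]

/-- The transfers preserve the total charge. -/
theorem sum_charge [Fintype G.Dart] :
    ∑ d, (ρ.vertexCharge d + ρ.faceCharge d) =
      ∑ d : G.Dart, (12 - 24 / (valency G d.fst : ℚ) - 24 / ρ.faceLength d) := by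
  have h1 : ∑ d : G.Dart, ρ.tri d.symm = ∑ d, ρ.tri d := Equiv.sum_comp (dartReverse G) ρ.tri
  have h2 : ∑ d : G.Dart, big (ρ.facePerm.symm d.symm) * ρ.tri d.symm = ∑ d, big d * ρ.tri d := by
    rw [← Equiv.sum_comp (dartReverse G * ρ.facePerm)]
    refine Finset.sum_congr rfl fun d _ => ?_
    change big (ρ.facePerm.symm (ρ.facePerm d).symm.symm) * ρ.tri (ρ.facePerm d).symm.symm = _
    rw [SimpleGraph.Dart.symm_symm, Equiv.symm_apply_apply, ← ρ.tri_facePerm_symm,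
      Equiv.symm_apply_apply]
  have h3 : ∀ d, ρ.vertexCharge d + ρ.faceCharge d =
      (12 - 24 / (valency G d.fst : ℚ) - 24 / ρ.faceLength d) + 2 * (ρ.tri d - ρ.tri d.symm) +
        (big (ρ.facePerm.symm d.symm) * ρ.tri d.symm - big d * ρ.tri d) := by
    intro d
    unfold vertexCharge faceCharge
    ring
  rw [Finset.sum_congr rfl fun d _ => h3 d, Finset.sum_add_distrib, Finset.sum_add_distrib,
    ← Finset.mul_sum]
  simp only [Finset.sum_sub_distrib, h1, h2]
  ring

section Vertices

variable {ρ} in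
-- Small faces do not share edges, so at most one of the three faces here has length at most 4. The
-- payments are 3 + 3 if there is one, and 2 + 2 + 2 otherwise.
theorem pay_next_sum [Finite V] (hG : IsObstruction G) {d : G.Dart} (h : valency G d.fst = 3) :
    ρ.pay d + ρ.pay (ρ.next d) + ρ.pay (ρ.next (ρ.next d)) = 6 := by
  have h0 := next_cube (ρ := ρ) h
  have e0 : ρ.next.symm d = ρ.next (ρ.next d) := by rw [Equiv.symm_apply_eq, h0]
  have key : ∀ e : G.Dart, ρ.faceLength e ≤ 4 → 5 ≤ ρ.faceLength (ρ.next e) := fun e he => by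
    rw [faceLength_next]; exact five_le_faceLength_symm hG he
  have k0 := key d
  have k1 := key (ρ.next d)
  have k2 := key (ρ.next (ρ.next d))
  unfold pay
  rw [symm_facePerm_symm, symm_facePerm_symm, symm_facePerm_symm, ← faceLength_next,
    ← faceLength_next, ← faceLength_next, Equiv.symm_apply_apply, Equiv.symm_apply_apply, e0, h0]
  rw [h0] at k2
  simp only [next_fst, h, true_and]
  split_ifs <;> first | (exfalso; omega) | norm_num

variable {ρ} in
-- At degree 3 the charge `pay - 2` is only zero on average over the three darts, hence the
-- summation over `next`. Degree 4 gives 0, and degree at least 5 leaves `6 - 24/5 - 1 = 1/5`.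
theorem sum_vertexCharge_ge [Finite V] [Fintype G.Dart] (hG : IsObstruction G) :
    ∑ d : G.Dart, big d / 5 ≤ ∑ d, ρ.vertexCharge d := by
  classical
  let k : G.Dart → ℚ := fun d => if valency G d.fst = 3 then ρ.pay d - 2 else 0
  have hk : ∑ d, k d = 0 := by
    have h1 : ∑ d, k (ρ.next d) = ∑ d, k d := Equiv.sum_comp ρ.next k
    have h2 : ∑ d, k (ρ.next (ρ.next d)) = ∑ d, k d :=
      (Equiv.sum_comp ρ.next fun d => k (ρ.next d)).trans h1
    have h3 : ∑ d, (k d + k (ρ.next d) + k (ρ.next (ρ.next d))) = 0 := by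
      refine Finset.sum_eq_zero fun d _ => ?_
      simp only [k, next_fst]
      split_ifs with h
      · linarith [pay_next_sum (ρ := ρ) hG h]
      · simp
    rw [Finset.sum_add_distrib, Finset.sum_add_distrib, h1, h2] at h3
    linarith
  have hle : ∑ d : G.Dart, (big d / 5 + k d) ≤ ∑ d, ρ.vertexCharge d := by
    refine Finset.sum_le_sum fun d _ => ?_
    have h3 := hG.three_le d.adj
    unfold vertexCharge
    simp only [k]
    by_cases h : valency G d.fst = 3
    · rw [if_pos h, h, big, if_neg (by omega)]
      norm_num
    · rw [if_neg h, ρ.pay_eq_zero h]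
      by_cases h4 : valency G d.fst = 4
      · rw [h4, big, if_neg (by omega)]
        norm_num
      · have h5 : 5 ≤ valency G d.fst := by omega
        rw [big, if_pos h5]
        have h6 : (5 : ℚ) ≤ valency G d.fst := by exact_mod_cast h5
        have h7 : (24 : ℚ) / valency G d.fst ≤ 24 / 5 := by gcongr
        linarith
  rw [Finset.sum_add_distrib, hk] at hle
  linarith

end Vertices

section Faces

variable {ρ} in
theorem faceCharge_nonneg [Finite V] (hG : IsObstruction G) {d : G.Dart} (h : ρ.faceLength d ≤ 4) :
    0 ≤ ρ.faceCharge d := by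
  have h3 := three_le_faceLength (ρ := ρ) hG d
  have h5 := five_le_faceLength_symm hG h
  have hb := big_nonneg d
  unfold faceCharge
  rw [ρ.pay_eq_zero_of_faceLength h, ρ.tri_eq_zero (d := d.symm) (by omega)]
  rcases (by omega : ρ.faceLength d = 3 ∨ ρ.faceLength d = 4) with e | e
  · rw [ρ.tri_eq_one e, e]
    norm_num
  · rw [ρ.tri_eq_zero (by omega), e]
    norm_num
    exact hb

theorem faceCharge_ge {d : G.Dart} (h : 5 ≤ ρ.faceLength d) :
    6 - 24 / ρ.faceLength d - ρ.pay d - 2 * ρ.tri d.symm ≤ ρ.faceCharge d := by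
  unfold faceCharge
  rw [ρ.tri_eq_zero (d := d) (by omega)]
  have h1 := big_nonneg d
  have h2 := mul_nonneg (big_nonneg (ρ.facePerm.symm d.symm)) (ρ.tri_nonneg d.symm)
  linarith

variable {ρ} in
-- Each dart of a 6-face has charge 2 and borders no triangle. Two consecutive darts pay at most 3
-- in all, as their initial vertices are not both of degree 3, so at least 1 remains for the pair.
theorem sum_six_ge [Finite V] [Fintype G.Dart] (hG : IsObstruction G) :
    ∑ d : G.Dart, (if ρ.faceLength d = 6 then (1 / 2 : ℚ) else 0) ≤
      ∑ d : G.Dart, if ρ.faceLength d = 6 then ρ.faceCharge d else 0 := by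
  let k : G.Dart → ℚ := fun d => if ρ.faceLength d = 6 then ρ.faceCharge d else 0
  have h1 : ∑ d, k (ρ.facePerm d) = ∑ d, k d := Equiv.sum_comp ρ.facePerm k
  have h2 : ∑ d : G.Dart, (if ρ.faceLength d = 6 then (1 : ℚ) else 0) ≤
      ∑ d, (k d + k (ρ.facePerm d)) := by
    refine Finset.sum_le_sum fun d _ => ?_
    simp only [k, faceLength_facePerm]
    split_ifs with h
    · have h' : ρ.faceLength (ρ.facePerm d) = 6 := by rw [faceLength_facePerm, h]
      have a := ρ.faceCharge_ge (d := d) (by omega)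
      have b := ρ.faceCharge_ge (d := ρ.facePerm d) (by omega)
      rw [ρ.tri_eq_zero (faceLength_symm_ne_three hG h), h] at a
      rw [ρ.tri_eq_zero (faceLength_symm_ne_three hG h'), h'] at b
      have hp : ρ.pay d + ρ.pay (ρ.facePerm d) ≤ 3 := by
        by_cases hv : valency G d.fst = 3
        · rw [ρ.pay_eq_zero (d := ρ.facePerm d)
            (fun hv' => ρ.not_valency_three_facePerm hG d ⟨hv, hv'⟩), add_zero]
          exact ρ.pay_le d
        · rw [ρ.pay_eq_zero hv, zero_add]
          exact ρ.pay_le _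
      norm_num at a b
      linarith
    · simp
  rw [Finset.sum_add_distrib, h1] at h2
  have h3 : ∑ d : G.Dart, (if ρ.faceLength d = 6 then (1 / 2 : ℚ) else 0) =
      1 / 2 * ∑ d : G.Dart, (if ρ.faceLength d = 6 then (1 : ℚ) else 0) := by
    rw [Finset.mul_sum]
    exact Finset.sum_congr rfl fun d _ => by split_ifs <;> norm_num
  rw [h3]
  change _ ≤ ∑ d, k d
  linarith

variable {ρ} in
-- At a vertex of degree 3, the two faces across these darts share the third edge, so they cannot
-- both be triangles.
theorem tri_symm_facePerm [Finite V] (hG : IsObstruction G) {d : G.Dart}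
    (h : valency G (ρ.facePerm d).fst = 3) (h1 : ρ.faceLength d.symm = 3)
    (h2 : ρ.faceLength (ρ.facePerm d).symm = 3) : False := by
  have h3 : ρ.next (ρ.next (ρ.facePerm d)) = d.symm := by
    have := next_cube (ρ := ρ) (d := d.symm) (by
      rw [← h, facePerm_fst]; rfl)
    rwa [← facePerm_apply] at this
  have h4 : ρ.faceLength (ρ.next (ρ.facePerm d)) = 3 := by rw [faceLength_next, h2]
  have h5 := five_le_faceLength_symm (ρ := ρ) hG (d := ρ.next (ρ.facePerm d)) (by omega)
  rw [← faceLength_next, h3] at h5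
  omega

variable {ρ} in
theorem sum_seven_ge [Finite V] [Fintype G.Dart] (hG : IsObstruction G) :
    ∑ d : G.Dart, (if 7 ≤ ρ.faceLength d then (1 / 14 : ℚ) else 0) ≤
      ∑ d : G.Dart, if 7 ≤ ρ.faceLength d then ρ.faceCharge d else 0 := by
  classical
  -- A dart starts with at least `6 - 24/7 = 18/7`. One that begins at degree 3 takes `1/2 + 2 *
  -- tri` from its predecessor, and `18/7 + 1/2 - 3 = 1/14` remains. The predecessor thereby covers
  -- at most one triangle in all, by `tri_symm_facePerm`, and keeps at least `18/7 - 1/2 - 2 =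
  -- 1/14`.
  let p : G.Dart → ℚ := fun d => if 7 ≤ ρ.faceLength d then
    if valency G d.fst = 3 then 1 / 2 + 2 * ρ.tri d.symm else 0 else 0
  have h1 : ∑ d, p (ρ.facePerm d) = ∑ d, p d := Equiv.sum_comp ρ.facePerm p
  have h2 : ∑ d : G.Dart, ((if 7 ≤ ρ.faceLength d then (1 / 14 : ℚ) else 0) +
      p (ρ.facePerm d)) ≤
      ∑ d : G.Dart, ((if 7 ≤ ρ.faceLength d then ρ.faceCharge d else 0) + p d) := by
    refine Finset.sum_le_sum fun d _ => ?_
    simp only [p, faceLength_facePerm]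
    by_cases h : 7 ≤ ρ.faceLength d
    · simp only [if_pos h]
      have a := ρ.faceCharge_ge (d := d) (by omega)
      have h6 : (7 : ℚ) ≤ ρ.faceLength d := by exact_mod_cast h
      have h7 : (24 : ℚ) / ρ.faceLength d ≤ 24 / 7 := by gcongr
      have hpay := ρ.pay_le d
      have ht := ρ.tri_le_one d.symm
      have ht0 := ρ.tri_nonneg d.symm
      have ht' := ρ.tri_le_one (ρ.facePerm d).symm
      by_cases hv : valency G d.fst = 3
      · have hv' : ¬ valency G (ρ.facePerm d).fst = 3 :=
          fun hv' => ρ.not_valency_three_facePerm hG d ⟨hv, hv'⟩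
        rw [if_pos hv, if_neg hv']
        linarith
      · rw [if_neg hv]
        rw [ρ.pay_eq_zero hv] at a
        split_ifs with hv'
        · have : ρ.tri d.symm + ρ.tri (ρ.facePerm d).symm ≤ 1 := by
            by_cases t1 : ρ.faceLength d.symm = 3
            · rw [ρ.tri_eq_zero (d := (ρ.facePerm d).symm)
                (fun t2 => tri_symm_facePerm hG hv' t1 t2)]
              linarith
            · rw [ρ.tri_eq_zero t1]
              linarith
          linarith
        · linarith
    · simp only [if_neg h]
      simp
  rw [Finset.sum_add_distrib, Finset.sum_add_distrib, h1] at h2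
  linarith

/-- The total final charge of a 5-face. -/
noncomputable def fiveCharge (d : G.Dart) : ℚ :=
  ρ.faceCharge d + ρ.faceCharge (ρ.facePerm d) + ρ.faceCharge (ρ.facePerm (ρ.facePerm d)) +
    ρ.faceCharge (ρ.facePerm (ρ.facePerm (ρ.facePerm d))) +
    ρ.faceCharge (ρ.facePerm (ρ.facePerm (ρ.facePerm (ρ.facePerm d))))

theorem sum_five [Fintype G.Dart] :
    ∑ d : G.Dart, (if ρ.faceLength d = 5 then ρ.fiveCharge d / 5 else 0) =
      ∑ d : G.Dart, if ρ.faceLength d = 5 then ρ.faceCharge d else 0 := by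
  let k : G.Dart → ℚ := fun d => if ρ.faceLength d = 5 then ρ.faceCharge d else 0
  have h1 : ∀ g : G.Dart → ℚ, ∑ d, g (ρ.facePerm d) = ∑ d, g d := Equiv.sum_comp ρ.facePerm
  have h2 : ∀ d, (if ρ.faceLength d = 5 then ρ.fiveCharge d / 5 else 0) =
      (k d + k (ρ.facePerm d) + k (ρ.facePerm (ρ.facePerm d)) +
        k (ρ.facePerm (ρ.facePerm (ρ.facePerm d))) +
        k (ρ.facePerm (ρ.facePerm (ρ.facePerm (ρ.facePerm d))))) * (1 / 5) := by
    intro d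
    simp only [k, faceLength_facePerm, fiveCharge]
    split_ifs <;> ring
  rw [Finset.sum_congr rfl fun d _ => h2 d, ← Finset.sum_mul]
  simp only [Finset.sum_add_distrib]
  rw [h1 fun d => k (ρ.facePerm (ρ.facePerm (ρ.facePerm d))),
    h1 fun d => k (ρ.facePerm (ρ.facePerm d)), h1 fun d => k (ρ.facePerm d), h1 k]
  change _ = ∑ d, k d
  ring

variable {ρ}

theorem FiveFace.fiveCharge_rotate {d₀ d₁ d₂ d₃ d₄ : G.Dart} (h : ρ.FiveFace d₀ d₁ d₂ d₃ d₄) :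
    ρ.fiveCharge d₁ = ρ.fiveCharge d₀ := by
  unfold fiveCharge
  simp only [h.h₀, h.h₁, h.h₂, h.h₃, h.h₄]
  ring

/-- Consecutive vertices of a face do not both take charge from it. -/
theorem pay_or (hG : IsObstruction G) {d e : G.Dart} (h : ρ.facePerm d = e) :
    valency G d.fst ≠ 3 ∨ valency G e.fst ≠ 3 := by
  by_contra hc
  push Not at hc
  exact ρ.not_valency_three_facePerm hG d ⟨hc.1, by rw [h]; exact hc.2⟩

theorem FiveFace.faceLength_eq {d₀ d₁ d₂ d₃ d₄ : G.Dart} (h : ρ.FiveFace d₀ d₁ d₂ d₃ d₄) :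
    ρ.faceLength d₁ = 5 ∧ ρ.faceLength d₂ = 5 ∧ ρ.faceLength d₃ = 5 ∧ ρ.faceLength d₄ = 5 :=
  ⟨h.rotate.length, h.rotate.rotate.length, h.rotate.rotate.rotate.length,
    h.rotate.rotate.rotate.rotate.length⟩

theorem faceCharge_five {d : G.Dart} (h : ρ.faceLength d = 5) :
    ρ.faceCharge d = 6 / 5 - ρ.pay d - 2 * ρ.tri d.symm + big d +
      big (ρ.facePerm.symm d.symm) * ρ.tri d.symm := by
  unfold faceCharge
  rw [ρ.tri_eq_zero (d := d) (by omega), h]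
  norm_num

theorem pay_le_two {d e : G.Dart} (h : ρ.facePerm d = e) (hd : 5 ≤ ρ.faceLength d.symm)
    (he : 5 ≤ ρ.faceLength e.symm) : ρ.pay e ≤ 2 := by
  have : ρ.facePerm.symm e = d := by rw [Equiv.symm_apply_eq, h]
  unfold pay
  rw [this]
  split_ifs with h1 h2
  · omega
  · norm_num
  · norm_num

/-- A 5-face with no triangle across its edges keeps its charge unless it has two vertices of
degree 3, each on a second small face. -/
theorem FiveFace.fiveCharge_of_ne {d₀ d₁ d₂ d₃ d₄ : G.Dart}
    (h : ρ.FiveFace d₀ d₁ d₂ d₃ d₄) (t₀ : ρ.faceLength d₀.symm ≠ 3)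
    (t₁ : ρ.faceLength d₁.symm ≠ 3) (t₂ : ρ.faceLength d₂.symm ≠ 3)
    (t₃ : ρ.faceLength d₃.symm ≠ 3) (t₄ : ρ.faceLength d₄.symm ≠ 3) :
    6 - (ρ.pay d₀ + ρ.pay d₁ + ρ.pay d₂ + ρ.pay d₃ + ρ.pay d₄) ≤ ρ.fiveCharge d₀ := by
  obtain ⟨l1, l2, l3, l4⟩ := h.faceLength_eq
  unfold fiveCharge
  simp only [h.h₀, h.h₁, h.h₂, h.h₃]
  rw [faceCharge_five h.length, faceCharge_five l1, faceCharge_five l2, faceCharge_five l3,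
    faceCharge_five l4, ρ.tri_eq_zero t₀, ρ.tri_eq_zero t₁, ρ.tri_eq_zero t₂, ρ.tri_eq_zero t₃,
    ρ.tri_eq_zero t₄]
  linarith [big_nonneg d₀, big_nonneg d₁, big_nonneg d₂, big_nonneg d₃, big_nonneg d₄]

/-- At most two of five cyclically arranged vertices are pairwise nonconsecutive, so at most two
receive 3 each. -/
theorem FiveFace.sum_pay_le {d₀ d₁ d₂ d₃ d₄ : G.Dart} (hG : IsObstruction G)
    (h : ρ.FiveFace d₀ d₁ d₂ d₃ d₄) :
    ρ.pay d₀ + ρ.pay d₁ + ρ.pay d₂ + ρ.pay d₃ + ρ.pay d₄ ≤ 6 := by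
  have p0 := ρ.pay_le d₀
  have p1 := ρ.pay_le d₁
  have p2 := ρ.pay_le d₂
  have p3 := ρ.pay_le d₃
  have p4 := ρ.pay_le d₄
  rcases pay_or hG h.h₀ with k | k <;> rcases pay_or hG h.h₂ with k' | k' <;>
    rcases pay_or hG h.h₁ with k'' | k'' <;> rcases pay_or hG h.h₃ with k3 | k3 <;>
    rcases pay_or hG h.h₄ with k4 | k4 <;>
    linarith [ρ.pay_eq_zero k, ρ.pay_eq_zero k', ρ.pay_eq_zero k'', ρ.pay_eq_zero k3,
      ρ.pay_eq_zero k4]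

theorem FiveFace.pay_eq_three {d₀ d₁ d₂ d₃ d₄ : G.Dart} (hG : IsObstruction G)
    (h : ρ.FiveFace d₀ d₁ d₂ d₃ d₄)
    (h6 : 6 ≤ ρ.pay d₀ + ρ.pay d₁ + ρ.pay d₂ + ρ.pay d₃ + ρ.pay d₄)
    (hv : valency G d₀.fst = 3) :
    ρ.pay d₀ = 3 ∧ (valency G d₂.fst = 3 ∨ valency G d₃.fst = 3) := by
  have p0 := ρ.pay_le d₀
  have p2 := ρ.pay_le d₂
  have p3 := ρ.pay_le d₃
  have v1 := ρ.pay_eq_zero ((pay_or hG h.h₀).resolve_left (not_not.2 hv))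
  have v4 := ρ.pay_eq_zero ((pay_or hG h.h₄).resolve_right (not_not.2 hv))
  by_cases v2 : valency G d₂.fst = 3
  · have v3 := ρ.pay_eq_zero ((pay_or hG h.h₂).resolve_left (not_not.2 v2))
    exact ⟨by linarith, Or.inl v2⟩
  · have v2' := ρ.pay_eq_zero v2
    by_cases v3 : valency G d₃.fst = 3
    · exact ⟨by linarith, Or.inr v3⟩
    · have v3' := ρ.pay_eq_zero v3
      linarith

/-- A 5-face with a triangle across one of its edges. -/
theorem FiveFace.fiveCharge_of_tri [Finite V] {d₀ d₁ d₂ d₃ d₄ : G.Dart} (hG : IsObstruction G)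
    (h : ρ.FiveFace d₀ d₁ d₂ d₃ d₄) (t₀ : ρ.faceLength d₀.symm = 3) :
    0 ≤ ρ.fiveCharge d₀ ∧ ((∀ v, valency G v ≤ 4) → 0 < ρ.fiveCharge d₀) := by
  obtain ⟨l1, l2, l3, l4⟩ := h.faceLength_eq
  obtain ⟨t1, t2, t3, t4⟩ := h.five_le_symm hG t₀
  have hk := face3_across t₀
  rw [h.h₀] at hk
  have p0 := ρ.pay_le d₀
  have p1 := ρ.pay_le d₁
  have p2 := pay_le_two h.h₁ t1 t2
  have p3 := pay_le_two h.h₂ t2 t3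
  have p4 := pay_le_two h.h₃ t3 t4
  have n0 := ρ.pay_nonneg d₀
  have n1 := ρ.pay_nonneg d₁
  have n2 := ρ.pay_nonneg d₂
  have n3 := ρ.pay_nonneg d₃
  have n4 := ρ.pay_nonneg d₄
  have hsum : ρ.fiveCharge d₀ = 4 - (ρ.pay d₀ + ρ.pay d₁ + ρ.pay d₂ + ρ.pay d₃ + ρ.pay d₄) +
      (big d₀ + big d₁ + big d₂ + big d₃ + big d₄ + big (ρ.facePerm.symm d₀.symm)) := by
    unfold fiveCharge
    simp only [h.h₀, h.h₁, h.h₂, h.h₃]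
    rw [faceCharge_five h.length, faceCharge_five l1, faceCharge_five l2, faceCharge_five l3,
      faceCharge_five l4, ρ.tri_eq_one t₀, ρ.tri_eq_zero (d := d₁.symm) (by omega),
      ρ.tri_eq_zero (d := d₂.symm) (by omega), ρ.tri_eq_zero (d := d₃.symm) (by omega),
      ρ.tri_eq_zero (d := d₄.symm) (by omega)]
    ring
  have b0 := big_nonneg d₀
  have b1 := big_nonneg d₁
  have b2 := big_nonneg d₂
  have b3 := big_nonneg d₃
  have b4 := big_nonneg d₄
  have b5 := big_nonneg (ρ.facePerm.symm d₀.symm)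
  have hsmall : valency G d₀.fst ≤ 4 → valency G d₁.fst ≤ 4 → valency G d₂.fst ≤ 4 →
      valency G d₃.fst ≤ 4 → valency G d₄.fst ≤ 4 →
      valency G (ρ.facePerm.symm d₀.symm).fst ≤ 4 → 1 ≤ ρ.fiveCharge d₀ := by
    intro v0 v1 v2 v3 v4 vx
    obtain ⟨c1, c2, c3, c4, c5⟩ := h.face5.not_two_valency_three hG hk v0 v1 v2 v3 v4 vx
    have z : ∀ {d e : G.Dart}, ¬ (valency G d.fst = 3 ∧ valency G e.fst = 3) →
        ρ.pay d = 0 ∨ ρ.pay e = 0 := fun hc =>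
      (not_and_or.1 hc).imp ρ.pay_eq_zero ρ.pay_eq_zero
    have z' : ∀ {d e : G.Dart}, ρ.facePerm d = e → ρ.pay d = 0 ∨ ρ.pay e = 0 := fun hc =>
      (pay_or hG hc).imp ρ.pay_eq_zero ρ.pay_eq_zero
    have y0 := z' h.h₀
    have y1 := z' h.h₁
    have y2 := z' h.h₂
    have y3 := z' h.h₃
    have y4 := z' h.h₄
    have y5 := z c1
    have y6 := z c2
    have y7 := z c3
    have y8 := z c4
    have y9 := z c5
    -- All ten pairs of vertices are now excluded from both having degree 3, so at most one payment
    -- is nonzero.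
    have hle : ρ.pay d₀ + ρ.pay d₁ + ρ.pay d₂ + ρ.pay d₃ + ρ.pay d₄ ≤ 3 := by
      by_cases q0 : ρ.pay d₀ = 0
      · by_cases q1 : ρ.pay d₁ = 0
        · by_cases q2 : ρ.pay d₂ = 0
          · rcases y3 with q | q <;> linarith
          · linarith [y2.resolve_left q2, y9.resolve_left q2]
        · linarith [y1.resolve_left q1, y7.resolve_left q1, y8.resolve_left q1]
      · linarith [y0.resolve_left q0, y5.resolve_left q0, y6.resolve_left q0,
          y4.resolve_right q0]
    linarith
  refine ⟨?_, fun hv => lt_of_lt_of_le one_pos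
    (hsmall (hv _) (hv _) (hv _) (hv _) (hv _) (hv _))⟩
  by_contra hneg
  -- Only the two consecutive vertices `d₀.fst` and `d₁.fst` border the triangle, so at most one
  -- payment of 3 occurs, along with at most one of 2. A deficit of 1 is covered as soon as one of
  -- the six vertices has degree at least 5.
  have hpay : ρ.pay d₀ + ρ.pay d₁ + ρ.pay d₂ + ρ.pay d₃ + ρ.pay d₄ ≤ 5 := by
    rcases pay_or hG h.h₀ with k | k <;> rcases pay_or hG h.h₂ with k' | k' <;>
      rcases pay_or hG h.h₁ with k'' | k'' <;> rcases pay_or hG h.h₃ with k3 | k3 <;>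
      rcases pay_or hG h.h₄ with k4 | k4 <;>
      linarith [ρ.pay_eq_zero k, ρ.pay_eq_zero k', ρ.pay_eq_zero k'', ρ.pay_eq_zero k3,
        ρ.pay_eq_zero k4]
  have hbig : ∀ d : G.Dart, big d < 1 → valency G d.fst ≤ 4 := by
    intro d hd
    by_contra hc
    rw [big, if_pos (by omega)] at hd
    exact lt_irrefl _ hd
  have := hsmall (hbig _ (by linarith)) (hbig _ (by linarith)) (hbig _ (by linarith))
    (hbig _ (by linarith)) (hbig _ (by linarith)) (hbig _ (by linarith))
  linarith

theorem FiveFace.fiveCharge_nonneg [Finite V] {d₀ d₁ d₂ d₃ d₄ : G.Dart} (hG : IsObstruction G)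
    (h : ρ.FiveFace d₀ d₁ d₂ d₃ d₄) : 0 ≤ ρ.fiveCharge d₀ := by
  have r1 := h.fiveCharge_rotate
  have r2 := h.rotate.fiveCharge_rotate
  have r3 := h.rotate.rotate.fiveCharge_rotate
  have r4 := h.rotate.rotate.rotate.fiveCharge_rotate
  by_cases t0 : ρ.faceLength d₀.symm = 3
  · exact (h.fiveCharge_of_tri hG t0).1
  by_cases t1 : ρ.faceLength d₁.symm = 3
  · linarith [(h.rotate.fiveCharge_of_tri hG t1).1]
  by_cases t2 : ρ.faceLength d₂.symm = 3
  · linarith [(h.rotate.rotate.fiveCharge_of_tri hG t2).1]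
  by_cases t3 : ρ.faceLength d₃.symm = 3
  · linarith [(h.rotate.rotate.rotate.fiveCharge_of_tri hG t3).1]
  by_cases t4 : ρ.faceLength d₄.symm = 3
  · linarith [(h.rotate.rotate.rotate.rotate.fiveCharge_of_tri hG t4).1]
  linarith [h.fiveCharge_of_ne t0 t1 t2 t3 t4, h.sum_pay_le hG]

end Faces

end RotationSystem

end Discharging

/-! ### The equality case and the final contradiction -/

section Conclusion

open Equiv Equiv.Perm

variable {V : Type*} {G : SimpleGraph V}

namespace RotationSystem

variable {ρ : RotationSystem G}

/-- On the torus or the sphere all charges vanish. -/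
theorem charges_eq_zero [Finite V] [Nonempty G.Dart] (hG : IsObstruction G)
    (hχ : 2 * (Nat.card G.ConnectedComponent : ℤ) - 2 ≤ ρ.eulerChar) (d : G.Dart) :
    valency G d.fst ≤ 4 ∧ ρ.faceLength d ≤ 5 ∧ (ρ.faceLength d = 5 → ρ.fiveCharge d = 0) := by
  classical
  have := finite_dart G
  have := Fintype.ofFinite G.Dart
  -- `P` collects the lower bounds for the final charges. Its total is at most the total charge,
  -- which is at most 0, while every value is nonnegative.
  let P : G.Dart → ℚ := fun d => big d / 5 +
    ((if ρ.faceLength d = 5 then ρ.fiveCharge d / 5 else 0) +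
      (if ρ.faceLength d = 6 then (1 / 2 : ℚ) else 0) +
      (if 7 ≤ ρ.faceLength d then (1 / 14 : ℚ) else 0))
  have hfive : ∀ d, ρ.faceLength d = 5 → 0 ≤ ρ.fiveCharge d := fun d h =>
    (fiveFace_of_faceLength h).fiveCharge_nonneg hG
  have hP : ∀ d, 0 ≤ P d := by
    intro d
    have h1 := big_nonneg d
    have h2 := hfive d
    simp only [P]
    split_ifs with a b c <;> first | (exfalso; omega) | skip
    · linarith [h2 a]
    all_goals linarith
  have hsum : ∑ d, P d ≤ 0 := by
    have h1 := sum_vertexCharge_ge (ρ := ρ) hG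
    have h2 := sum_six_ge (ρ := ρ) hG
    have h3 := sum_seven_ge (ρ := ρ) hG
    have h4 := ρ.sum_five
    have h5 := ρ.sum_curvature_nonneg hχ
    have h6 := ρ.sum_charge
    have h7 : ∑ d : G.Dart, (12 - 24 / (valency G d.fst : ℚ) - 24 / ρ.faceLength d) =
        -24 * ∑ d : G.Dart, ((1 : ℚ) / valency G d.fst + 1 / ρ.faceLength d - 1 / 2) := by
      rw [Finset.mul_sum]
      exact Finset.sum_congr rfl fun d _ => by ring
    have h8 : ∑ d : G.Dart, ((if ρ.faceLength d = 5 then ρ.faceCharge d else 0) +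
        (if ρ.faceLength d = 6 then ρ.faceCharge d else 0) +
        (if 7 ≤ ρ.faceLength d then ρ.faceCharge d else 0)) ≤ ∑ d, ρ.faceCharge d := by
      refine Finset.sum_le_sum fun d _ => ?_
      have h9 := faceCharge_nonneg (ρ := ρ) hG (d := d)
      split_ifs with a b c <;> first | (exfalso; omega) | skip
      · linarith
      · linarith
      · linarith
      · linarith [h9 (by omega)]
    simp only [P, Finset.sum_add_distrib] at h8 ⊢
    rw [Finset.sum_add_distrib] at h6
    linarith
  have hzero : P d = 0 := by
    have := (Finset.sum_eq_zero_iff_of_nonneg fun d _ => hP d).1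
      (le_antisymm hsum (Finset.sum_nonneg fun d _ => hP d))
    exact this d (Finset.mem_univ d)
  have h1 := big_nonneg d
  have h2 := hfive d
  have hv : valency G d.fst ≤ 4 := by
    by_contra hc
    have hb : big d = 1 := if_pos (by omega)
    simp only [P, hb] at hzero
    split_ifs at hzero with a b c <;> first | (linarith [h2 a]) | linarith
  refine ⟨hv, ?_, ?_⟩
  · by_contra hc
    simp only [P] at hzero
    split_ifs at hzero with a b c <;> first | omega | linarith
  · intro h
    simp only [P, if_pos h] at hzero
    have := h2 h
    split_ifs at hzero with b c <;> first | omega | linarith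

theorem not_isObstruction [Finite V] [Nonempty G.Dart] (hG : IsObstruction G)
    (hχ : 2 * (Nat.card G.ConnectedComponent : ℤ) - 2 ≤ ρ.eulerChar) : False := by
  have hz := charges_eq_zero (ρ := ρ) hG hχ
  have h4 : ∀ v, valency G v ≤ 4 := by
    intro v
    by_contra hc
    have hne : (G.neighborSet v).ncard ≠ 0 := by unfold valency at hc; omega
    obtain ⟨w, hw⟩ := Set.nonempty_of_ncard_ne_zero hne
    exact hc (hz ⟨(v, w), hw⟩).1
  have htri : ∀ d, ρ.faceLength d = 5 → ρ.faceLength d.symm ≠ 3 := fun d h h3 =>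
    (((fiveFace_of_faceLength h).fiveCharge_of_tri hG h3).2 h4).ne' ((hz d).2.2 h)
  -- The face across an edge of a triangle would be a 5-face, and with all degrees at most 4 its
  -- charge would be positive.
  have hne3 : ∀ d, ρ.faceLength d ≠ 3 := by
    intro d h3
    have h5 : 5 ≤ ρ.faceLength d.symm := five_le_faceLength_symm hG (by omega)
    have h5' := (hz d.symm).2.1
    exact htri d.symm (by omega) (by rwa [SimpleGraph.Dart.symm_symm])
  have hpay : ∀ {d₀ d₁ d₂ d₃ d₄ : G.Dart}, ρ.FiveFace d₀ d₁ d₂ d₃ d₄ →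
      6 ≤ ρ.pay d₀ + ρ.pay d₁ + ρ.pay d₂ + ρ.pay d₃ + ρ.pay d₄ := by
    intro d₀ d₁ d₂ d₃ d₄ h
    have h1 := h.fiveCharge_of_ne (hne3 _) (hne3 _) (hne3 _) (hne3 _) (hne3 _)
    have h2 := (hz d₀).2.2 h.length
    linarith
  have hthree : ∀ {d₀ d₁ d₂ d₃ d₄ : G.Dart}, ρ.FiveFace d₀ d₁ d₂ d₃ d₄ →
      valency G d₀.fst = 3 → valency G d₂.fst = 3 ∨ valency G d₃.fst = 3 := fun h hv =>
    (h.pay_eq_three hG (hpay h) hv).2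
  obtain ⟨d, hd⟩ : ∃ d, ρ.faceLength d = 5 := by
    obtain ⟨d⟩ := ‹Nonempty G.Dart›
    by_cases h5 : ρ.faceLength d ≤ 4
    · have h6 := five_le_faceLength_symm hG h5
      have h7 := (hz d.symm).2.1
      exact ⟨d.symm, by omega⟩
    · have h7 := (hz d).2.1
      exact ⟨d, by omega⟩
  obtain ⟨e, he, hev⟩ : ∃ e, ρ.faceLength e = 5 ∧ valency G e.fst = 3 := by
    have h := fiveFace_of_faceLength hd
    have h6 := hpay h
    obtain ⟨l1, l2, l3, l4⟩ := h.faceLength_eq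
    by_contra hc
    push Not at hc
    rw [ρ.pay_eq_zero (hc _ hd), ρ.pay_eq_zero (hc _ l1), ρ.pay_eq_zero (hc _ l2),
      ρ.pay_eq_zero (hc _ l3), ρ.pay_eq_zero (hc _ l4)] at h6
    norm_num at h6
  -- A payment of 3 rather than 2 signals a face of length at most 4 beside the corner. In the
  -- absence of triangles it is a 4-face.
  obtain ⟨g, hg, hgv⟩ : ∃ g, ρ.faceLength g = 4 ∧ valency G g.fst = 3 := by
    have h := fiveFace_of_faceLength he
    have h3 := (h.pay_eq_three hG (hpay h) hev).1
    unfold pay at h3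
    split_ifs at h3 with k1 k2
    · rw [symm_facePerm_symm, ← faceLength_next] at k2
      rcases k2 with k2 | k2
      · have := three_le_faceLength (ρ := ρ) hG (ρ.next e)
        have := hne3 (ρ.next e)
        exact ⟨ρ.next e, by omega, by rwa [next_fst]⟩
      · have := three_le_faceLength (ρ := ρ) hG (ρ.next.symm e)
        have := hne3 (ρ.next.symm e)
        refine ⟨ρ.next.symm e, by omega, ?_⟩
        rwa [← ρ.next_fst, Equiv.apply_symm_apply]
    · norm_num at h3
    · norm_num at h3
  have hlast : ∀ {e f : G.Dart}, ρ.facePerm e = f → e.fst = (ρ.next.symm f).snd := by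
    intro e f hef
    rw [← hef, facePerm_apply, Equiv.symm_apply_apply]
    rfl
  have hcube := next_cube (ρ := ρ) hgv
  set l := ρ.next g with hl
  set k := ρ.next l with hk
  have hl5 : ρ.faceLength l = 5 := by
    have h1 : 5 ≤ ρ.faceLength g.symm := five_le_faceLength_symm hG (by omega)
    have h2 := (hz l).2.1
    rw [hl, faceLength_next] at h2 ⊢
    omega
  have hk5 : ρ.faceLength k = 5 := by
    have h1 : ¬ ρ.faceLength k ≤ 4 := by
      intro h4
      have h5 := five_le_faceLength_symm hG h4
      rw [← faceLength_next, hcube] at h5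
      omega
    have h2 := (hz k).2.1
    omega
  have hlg : l.fst = g.fst := ρ.next_fst g
  have hkg : k.fst = g.fst := (ρ.next_fst l).trans hlg
  have fk := fiveFace_of_faceLength hk5
  have fl := fiveFace_of_faceLength hl5
  have vk := hthree fk (by rw [hkg, hgv])
  have vl := hthree fl (by rw [hlg, hgv])
  have q := ρ.face4_of_faceLength hg
  have q4 : ρ.facePerm (ρ.facePerm (ρ.facePerm (ρ.facePerm g))) = g :=
    ρ.facePerm_pow_faceLength hg
  -- Consecutive faces around the vertex share an edge, so the last vertex of one face is the second
  -- vertex of another. This matches the three faces with the hypotheses of `not_hub`.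
  have hr : (ρ.facePerm (ρ.facePerm (ρ.facePerm g))).fst = (ρ.facePerm k).fst := by
    rw [hlast q4, ρ.facePerm_fst k]
    congr 2
    rw [Equiv.symm_apply_eq, hcube]
  have hs : (ρ.facePerm (ρ.facePerm (ρ.facePerm (ρ.facePerm k)))).fst = (ρ.facePerm l).fst := by
    rw [hlast fk.h₄, ρ.facePerm_fst l]
    congr 2
    rw [Equiv.symm_apply_eq]
  have hp : (ρ.facePerm (ρ.facePerm (ρ.facePerm (ρ.facePerm l)))).fst = (ρ.facePerm g).fst := by
    rw [hlast fl.h₄, ρ.facePerm_fst g]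
    congr 2
    rw [Equiv.symm_apply_eq]
  have f5 := fk.face5
  have f5' := fl.face5
  rw [hr] at q
  rw [hkg, hs] at f5
  rw [hlg, hp] at f5'
  exact not_hub hG q f5 f5' h4 hgv vk vl

end RotationSystem

theorem IsToroidal.isDecomposable [Finite V] (hT : IsToroidal G) (hA : AvoidsConfigurations G) :
    IsDecomposable 2 1 G := by
  refine isDecomposable_of_hasReducible G fun A ⟨v, hv⟩ hdeg => ?_
  by_contra hred
  have hG : IsObstruction (restrictTo G A) :=
    ⟨hA.anti (restrictTo_le G A), fun h => hdeg _ h.2.1, hred⟩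
  obtain ⟨ρ, hρ⟩ := hT.anti (restrictTo_le G A)
  have hne : ((restrictTo G A).neighborSet v).ncard ≠ 0 := by
    have := hdeg v hv
    unfold valency at this
    omega
  obtain ⟨w, hw⟩ := Set.nonempty_of_ncard_ne_zero hne
  have : Nonempty (restrictTo G A).Dart := ⟨⟨(v, w), hw⟩⟩
  exact RotationSystem.not_isObstruction hG hρ

end Conclusion

end ToroidalDecomposition

theorem theorem1p7 {V : Type*} [Finite V] (G : SimpleGraph V)
    (hG : ToroidalDecomposition.IsToroidal G) :
    (ToroidalDecomposition.AvoidsConfigurations G →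
      ToroidalDecomposition.IsDecomposable 2 1 G) ∧
    (∀ i j : ℕ, (i, j) ∈ ({(3, 4), (3, 6), (4, 6), (4, 7)} : Set (ℕ × ℕ)) →
      ToroidalDecomposition.HasNoCycleOfLength i G →
      ToroidalDecomposition.HasNoCycleOfLength j G →
      ToroidalDecomposition.AvoidsConfigurations G) :=
  ⟨hG.isDecomposable, fun _ _ hij hi hj =>
    ToroidalDecomposition.avoidsConfigurations_of_hasNoCycleOfLength hij hi hj⟩
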